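/- **Model.** For $n,d\ge 1$, a positive semidefinite $\Sigma\in\mathbb R^{d\times d}$, $\zeta\ge 0$ and $\theta^*\in\mathbb R^d$, let $P_{\Sigma,\zeta,\theta^*}$ be the law of $(x,y)$ with $x\sim\mathcal N(0,\Sigma)$, $y=x^\top\theta^*+z$, where $z\sim\mathcal N(0,\zeta^2)$ is independent of $x$. The dataset $D=((x_i,y_i))_{i\le n}$ consists of $n$ i.i.d. samples from $P_{\Sigma,\zeta,\theta^*}$. The excess test risk of $\theta\in\mathbb R^d$ is $$\mathcal R(\theta)=\tfrac12\,\mathbb E_{(x,y)\sim P_{\Sigma,\zeta,\theta^*}}\big[(x^\top\theta-y)^2\big]-\tfrac{\zeta^2}{2}.$$ An algorithm is a Markov kernel $\mathcal M$ from datasets $(\mathbb R^d\times\mathbb R)^n$ to $\mathbb R^d$. For $\rho>0$, it is $\rho^2/2$-zCDP if, for every pair of datasets $D,D'$ that differ in at most one sample and every $\alpha>1$, $$D_\alpha(\mathcal M(D)\,\|\,\mathcal M(D'))\le \alpha\rho^2/2,\qquad D_\alpha(\mu\|\nu)=\frac1{\alpha-1}\ln\int\Big(\frac{d\mu}{d\nu}\Big)^{\alpha}d\nu,$$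 with $D_\alpha(\mu\|\nu)=+\infty$ if $\mu\not\ll\nu$. Let $\mathbb M_\rho$ be the set of these algorithms, and $$\mathfrak R_{n}(\Sigma,\zeta,\rho)=\inf_{\mathcal M\in\mathbb M_\rho}\ \sup_{\|\theta^*\|_2<1}\ \mathbb E\big[\mathcal R(\theta^p)\big]\in[0,\infty],$$ where $\theta^p$ is the output of $\mathcal M$ on $D$ and $\mathbb E$ is over the data and the algorithm. **Theorem.** Let $\underline\lambda>0$, $\overline\lambda$, $\underline v>0$, $\overline v$ and $K$ be real constants. There exist $C>0$ and $\gamma_0>0$, depending only on these constants, such that the following holds for every $\gamma\in(0,\gamma_0)$ and every $\rho>0$ with $\gamma^2/\rho^2\le K$. Let $n_k,d_k\to\infty$ be sequences of natural numbers with $d_k/n_k\to\gamma$, let $\Sigma_k\in\mathbb R^{d_k\times d_k}$ be positive semidefinite matrices whose eigenvalues all lie in $[\underline\lambda,\overline\lambda]$ and with $\operatorname{tr}(\Sigma_k)=d_k$, and let $\zeta_k\ge 0$ satisfy $\zeta_k^2\in[\underline v,\overline v]$. Then, for all sufficiently large $k$, $$\mathfrak R_{n_k}(\Sigma_k,\zeta_k,\rho)\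 \ge\ C\left(\gamma+\frac{\gamma^2}{\rho^2}\right).$$ -/

import Mathlib

open MeasureTheory ProbabilityTheory Filter Topology
open scoped ENNReal NNReal

noncomputable section

namespace DPReg

/-- A labelled sample `(x, y)` with `x ∈ ℝᵈ` (Euclidean norm) and `y ∈ ℝ`. -/
abbrev Sample (d : ℕ) : Type := EuclideanSpace ℝ (Fin d) × ℝ

/-- A training set `(X, Y)` of `n` labelled samples. -/
abbrev Dataset (n d : ℕ) : Type := Fin n → Sample d

/-- A randomized algorithm: a measurable map from datasets to measures on the parameter space `ℝᵈ`.
It is required to be a Markov kernel (`IsMarkovKernel`) wherever it is used. -/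
abbrev Algorithm (n d : ℕ) : Type := Kernel (Dataset n d) (EuclideanSpace ℝ (Fin d))

/-- Law of `(x, y)` in the Gaussian linear model: `x ∼ N(0, S)`, `z ∼ N(0, ζ²)` independent of `x`,
and `y = xᵀ θs + z`. -/
def sampleLaw {d : ℕ} (S : Matrix (Fin d) (Fin d) ℝ) (ζ : ℝ≥0)
    (θs : EuclideanSpace ℝ (Fin d)) : Measure (Sample d) :=
  ((multivariateGaussian 0 S).prod (gaussianReal 0 (ζ ^ 2))).map
    fun p => (p.1, inner ℝ p.1 θs + p.2)

/-- Law of a training set of `n` i.i.d. samples. -/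
def dataLaw (n : ℕ) {d : ℕ} (S : Matrix (Fin d) (Fin d) ℝ) (ζ : ℝ≥0)
    (θs : EuclideanSpace ℝ (Fin d)) : Measure (Dataset n d) :=
  Measure.pi fun _ => sampleLaw S ζ θs

/-- Test risk `½ E[(xᵀ θ - y)²]` of the parameter `θ`, on a fresh sample `(x, y)`. -/
def testRisk {d : ℕ} (S : Matrix (Fin d) (Fin d) ℝ) (ζ : ℝ≥0)
    (θs θ : EuclideanSpace ℝ (Fin d)) : ℝ :=
  (1 / 2) * ∫ p, (inner ℝ p.1 θ - p.2) ^ 2 ∂(sampleLaw S ζ θs)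

/-- Excess test risk: the test risk minus `ζ² / 2`, so that it vanishes at `θ = θs`. -/
def excessRisk {d : ℕ} (S : Matrix (Fin d) (Fin d) ℝ) (ζ : ℝ≥0)
    (θs θ : EuclideanSpace ℝ (Fin d)) : ℝ :=
  testRisk S ζ θs θ - (ζ : ℝ) ^ 2 / 2

/-- Expected excess risk of the output of the algorithm `M`, over the randomness of the data and of
the algorithm; it takes values in `[0, ∞]`. -/
def expectedExcessRisk {n d : ℕ} (S : Matrix (Fin d) (Fin d) ℝ) (ζ : ℝ≥0)
    (M : Algorithm n d) (θs : EuclideanSpace ℝ (Fin d)) : ℝ≥0∞ :=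
  ∫⁻ D, ∫⁻ θ, ENNReal.ofReal (excessRisk S ζ θs θ) ∂(M D) ∂(dataLaw n S ζ θs)

open Classical in
/-- Rényi divergence `D_α(μ ‖ ν) = (α - 1)⁻¹ log ∫ (dμ/dν)^α dν` of order `α > 1`, equal to `⊤` when
`μ` is not absolutely continuous with respect to `ν`. -/
def renyiDiv {E : Type*} [MeasurableSpace E] (α : ℝ) (μ ν : Measure E) : EReal :=
  if μ ≪ ν then
    (((α - 1)⁻¹ : ℝ) : EReal) * ENNReal.log (∫⁻ x, (μ.rnDeriv ν x) ^ α ∂ν)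
  else ⊤

/-- Two datasets are adjacent if they differ in at most one sample. -/
def Adjacent {n d : ℕ} (D D' : Dataset n d) : Prop :=
  ∃ i, ∀ j, j ≠ i → D j = D' j

/-- `r`-zero-concentrated differential privacy. -/
def IsZCDP {n d : ℕ} (r : ℝ) (M : Algorithm n d) : Prop :=
  ∀ D D' : Dataset n d, Adjacent D D' → ∀ α : ℝ, 1 < α →
    renyiDiv α (M D) (M D') ≤ ((α * r : ℝ) : EReal)

/-- Minimax expected excess risk: infimum over all `ρ² / 2`-zCDP algorithms of the supremum over
`‖θs‖ < 1` of the expected excess risk. -/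
def minimaxRisk (n : ℕ) {d : ℕ} (S : Matrix (Fin d) (Fin d) ℝ) (ζ : ℝ≥0) (ρ : ℝ) : ℝ≥0∞ :=
  ⨅ (M : Algorithm n d) (_ : IsMarkovKernel M) (_ : IsZCDP (ρ ^ 2 / 2) M),
    ⨆ (θs : EuclideanSpace ℝ (Fin d)) (_ : ‖θs‖ < 1), expectedExcessRisk S ζ M θs

end DPReg

end

/-! The argument is Bayesian: the parameter is uniform on the cube [-a, a]^d with d a² = 1/4, which
lies in the unit ball. Since the eigenvalues are at least `lmin`, the excess risk is at least `lmin`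
/ 2 times the squared error. Truncating the output to the cube only decreases that error, so it is
enough to bound the truncated error from below, where the estimators are bounded.

For a fixed dataset with likelihood ratio L(ϑ), integrating ∂_j[(a² - ϑ_j²) L(ϑ)] over ϑ_j gives
zero, because the weight vanishes at ±a (`integral_uniformCube_weightedScore`). Averaged over prior
and data, this says that the error plus the correlation of the weighted error with the score is at
least d a² / 3 = 1/12 (`cube_lower_bound`): an accurate output must correlate with the score of its
own data.

That correlation is bounded above in two ways. The Fisher information n tr(S) / ζ² and
Cauchy–Schwarz (`scoreCorrelation_le_of_fisher`) force an error of order γ. For privacy, the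
correlation is split over samples. Replacing sample i by an independent copy makes it independent of
the output, so its contribution becomes centred with variance controlled by the error; zCDP bounds
the χ² price of the replacement by exp(ρ²) - 1 (`integral_trace_le`,
`scoreCorrelation_le_of_isZCDP`). For ρ ≤ 1 this forces an error of order γ² / ρ². For ρ ≥ 1 and γ <
1 one has γ² / ρ² ≤ γ, and the first bound suffices. `le_minimaxRisk` combines the two. -/

noncomputable section

namespace DPReg

/-! ### Resampling one coordinate, and change of measure at bounded χ² divergence -/

section Resampling

variable {ι X : Type*} [Fintype ι] [DecidableEq ι] [MeasurableSpace X]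

/-- Exchanging one coordinate of an i.i.d. family with an independent copy preserves the law. -/
lemma measurePreserving_update_swap (P : Measure X) [IsProbabilityMeasure P] (i : ι) :
    MeasurePreserving (fun p : (ι → X) × X => (Function.update p.1 i p.2, p.1 i))
      ((Measure.pi fun _ => P).prod P) ((Measure.pi fun _ => P).prod P) := by
  have hm : Measurable (fun p : (ι → X) × X => (Function.update p.1 i p.2, p.1 i)) := by
    refine Measurable.prodMk ?_ (by fun_prop)
    rw [measurable_pi_iff]
    intro j
    by_cases h : j = i
    · subst h; simpa using measurable_snd
    · simp only [Function.update_of_ne h]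
      fun_prop
  refine ⟨hm, ?_⟩
  symm
  refine Measure.prod_eq_generateFrom (generateFrom_pi (ι := ι) (α := fun _ => X))
    (MeasurableSpace.generateFrom_measurableSet) isPiSystem_pi
    MeasurableSpace.isPiSystem_measurableSet
    ⟨fun _ => Set.univ, fun _ => ⟨fun _ => Set.univ, by simp, by simp⟩, by simp, by simp [Set.iUnion_const]⟩
    ⟨fun _ => Set.univ, by simp, by simp, by simp [Set.iUnion_const]⟩ ?_
  rintro _ ⟨s, hs, rfl⟩ B hB
  have hs' : ∀ j, MeasurableSet (s j) := fun j => hs j (Set.mem_univ j)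
  rw [Measure.map_apply hm ((MeasurableSet.univ_pi hs').prod hB)]
  have hpre : (fun p : (ι → X) × X => (Function.update p.1 i p.2, p.1 i)) ⁻¹'
      (Set.univ.pi s ×ˢ B) = (Set.univ.pi (Function.update s i B)) ×ˢ (s i) := by
    ext ⟨D, x⟩
    simp only [Set.mem_preimage, Set.mem_prod, Set.mem_pi, Set.mem_univ, true_implies]
    constructor
    · rintro ⟨h1, h2⟩
      refine ⟨fun j => ?_, by simpa using h1 i⟩
      by_cases h : j = i
      · subst h; simpa using h2
      · simpa [Function.update_of_ne h] using h1 j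
    · rintro ⟨h1, h2⟩
      refine ⟨fun j => ?_, by simpa using h1 i⟩
      by_cases h : j = i
      · subst h; simpa using h2
      · simpa [Function.update_of_ne h] using h1 j
  rw [hpre, Measure.prod_prod, Measure.pi_pi, Measure.pi_pi]
  rw [← Finset.mul_prod_erase Finset.univ _ (Finset.mem_univ i),
    ← Finset.mul_prod_erase Finset.univ (fun j => P (s j)) (Finset.mem_univ i)]
  have : ∏ j ∈ Finset.univ.erase i, P (Function.update s i B j)
      = ∏ j ∈ Finset.univ.erase i, P (s j) :=
    Finset.prod_congr rfl fun j hj => by rw [Function.update_of_ne (Finset.ne_of_mem_erase hj)]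
  rw [this]
  simp only [Function.update_self]
  ring

/-- Applied to the prior: redrawing one coordinate of the parameter reduces an average over the cube
to a one-dimensional integral. -/
lemma measurePreserving_update (P : Measure X) [IsProbabilityMeasure P] (i : ι) :
    MeasurePreserving (fun p : (ι → X) × X => Function.update p.1 i p.2)
      ((Measure.pi fun _ => P).prod P) (Measure.pi fun _ => P) :=
  measurePreserving_fst.comp (measurePreserving_update_swap P i)

end Resampling

/-- Comparison of expectations under two measures at bounded `χ²` divergence. -/
lemma integral_le_of_lintegral_rnDeriv_sq_le {E : Type*} [MeasurableSpace E] {μ ν : Measure E}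
    [IsProbabilityMeasure μ] [IsProbabilityMeasure ν] {χ : ℝ}
    (hμν : μ ≪ ν) (hχ : ∫⁻ x, (μ.rnDeriv ν x) ^ (2 : ℝ) ∂ν ≤ ENNReal.ofReal (1 + χ)) {f : E → ℝ}
    (hf : Measurable f) {b : ℝ} (hb : ∀ x, |f x| ≤ b) {η : ℝ} (hη : 0 < η) :
    ∫ x, f x ∂μ ≤ ∫ x, (f x + 1 / (2 * η) * f x ^ 2) ∂ν + η / 2 * χ := by
  set r : E → ℝ := fun x => (μ.rnDeriv ν x).toReal
  have hrm : Measurable r := (Measure.measurable_rnDeriv μ ν).ennreal_toReal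
  have hr1 : ∫ x, r x ∂ν = 1 := by
    rw [Measure.integral_toReal_rnDeriv hμν]; simp
  have hri : Integrable r ν := Measure.integrable_toReal_rnDeriv
  have hlt : ∀ᵐ x ∂ν, ENNReal.ofReal (r x ^ 2) = (μ.rnDeriv ν x) ^ (2 : ℝ) := by
    filter_upwards [Measure.rnDeriv_lt_top μ ν] with x hx
    rw [ENNReal.ofReal_pow ENNReal.toReal_nonneg, ENNReal.ofReal_toReal hx.ne]
    norm_cast
  have hl : ∫⁻ x, ENNReal.ofReal (r x ^ 2) ∂ν ≤ ENNReal.ofReal (1 + χ) := by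
    rw [lintegral_congr_ae hlt]; exact hχ
  have hr2i : Integrable (fun x => r x ^ 2) ν := by
    refine ⟨(hrm.pow_const 2).aestronglyMeasurable, ?_⟩
    rw [hasFiniteIntegral_iff_ofReal (ae_of_all _ fun x => sq_nonneg _)]
    exact lt_of_le_of_lt hl ENNReal.ofReal_lt_top
  have hr2 : ∫ x, r x ^ 2 ∂ν ≤ 1 + χ := by
    -- `ENNReal.ofReal` sends negative numbers to 0, so a negative 1 + χ would force the density r
    -- to vanish almost everywhere, against ∫ r = 1.
    have h0 : 0 ≤ 1 + χ := by
      by_contra h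
      rw [ENNReal.ofReal_of_nonpos (by linarith), nonpos_iff_eq_zero,
        lintegral_eq_zero_iff (by fun_prop)] at hl
      have : r =ᵐ[ν] 0 := by
        filter_upwards [hl] with x hx
        have : r x ^ 2 ≤ 0 := by simpa using hx
        simpa using le_antisymm this (sq_nonneg _)
      rw [integral_congr_ae this] at hr1
      simp at hr1
    rw [integral_eq_lintegral_of_nonneg_ae (ae_of_all _ fun x => sq_nonneg _)
      (hrm.pow_const 2).aestronglyMeasurable]
    exact ENNReal.toReal_le_of_le_ofReal h0 hl
  have hfi : Integrable f ν := Integrable.of_bound hf.aestronglyMeasurable b (ae_of_all _ hb)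
  have hf2i : Integrable (fun x => f x ^ 2) ν :=
    Integrable.of_bound (hf.pow_const 2).aestronglyMeasurable (b ^ 2) (ae_of_all _ fun x => by
      rw [Real.norm_eq_abs, abs_pow]; exact pow_le_pow_left₀ (abs_nonneg _) (hb x) 2)
  have hrfi : Integrable (fun x => r x * f x) ν :=
    hri.mul_bdd (c := b) hf.aestronglyMeasurable (ae_of_all _ hb)
  have hmain : ∫ x, r x * f x ∂ν = ∫ x, f x ∂μ := by
    have := integral_rnDeriv_smul (f := f) hμν
    simpa [smul_eq_mul] using this
  rw [← hmain]
  have hi1 : Integrable (fun x => f x + 1 / (2 * η) * f x ^ 2) ν := hfi.add (hf2i.const_mul _)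
  have hi2 : Integrable (fun x => η / 2 * (r x ^ 2 - 2 * r x + 1)) ν :=
    ((hr2i.sub (hri.const_mul 2)).add (integrable_const 1)).const_mul _
  calc ∫ x, r x * f x ∂ν
      ≤ ∫ x, (f x + 1 / (2 * η) * f x ^ 2) + η / 2 * (r x ^ 2 - 2 * r x + 1) ∂ν := by
        refine integral_mono hrfi (hi1.add hi2) fun x => ?_
        -- Young's inequality for (r - 1) f, by completing the square; ∫ (r - 1)² is then at most χ
        -- because ∫ r = 1.
        have : (f x + 1 / (2 * η) * f x ^ 2) + η / 2 * (r x ^ 2 - 2 * r x + 1) - r x * f x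
          = 1 / (2 * η) * (f x - η * (r x - 1)) ^ 2 := by field_simp; ring
        have h0 : 0 ≤ 1 / (2 * η) * (f x - η * (r x - 1)) ^ 2 := by positivity
        linarith
    _ = ∫ x, (f x + 1 / (2 * η) * f x ^ 2) ∂ν
          + η / 2 * (∫ x, r x ^ 2 ∂ν - 2 * 1 + 1) := by
        have e : ∫ x, (r x ^ 2 - 2 * r x + 1) ∂ν = ∫ x, r x ^ 2 ∂ν - 2 * 1 + 1 := by
          have i0 : Integrable (fun x => r x ^ 2 - 2 * r x) ν := hr2i.sub (hri.const_mul 2)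
          rw [integral_add i0 (integrable_const 1), integral_sub hr2i (hri.const_mul 2),
            integral_const_mul, hr1]
          simp
        rw [integral_add hi1 hi2, integral_const_mul, e]
    _ ≤ _ := by nlinarith

lemma abs_integral_le_of_abs_le {E : Type*} [MeasurableSpace E] {μ : Measure E}
    [IsProbabilityMeasure μ] {f : E → ℝ} {b : ℝ} (h : ∀ x, |f x| ≤ b) : |∫ x, f x ∂μ| ≤ b := by
  simpa using norm_integral_le_of_norm_le_const (μ := μ) (f := f) (ae_of_all _ h)

/-! ### Tracing: a stable output hardly correlates with any single sample -/

section Soundness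

variable {X E : Type*} [MeasurableSpace X] [MeasurableSpace E] {n : ℕ}

/-- Tracing bound: if replacing one sample changes the output law of `M` by at most `χ` in `χ²`
divergence, then the output correlates little with a centred statistic of that sample. -/
lemma integral_trace_le (P : Measure X) [IsProbabilityMeasure P] (M : Kernel (Fin n → X) E)
    [IsMarkovKernel M] (i : Fin n) {χ : ℝ}
    (hM : ∀ D x, M D ≪ M (Function.update D i x) ∧
      ∫⁻ m, ((M D).rnDeriv (M (Function.update D i x)) m) ^ (2 : ℝ) ∂(M (Function.update D i x))
        ≤ ENNReal.ofReal (1 + χ))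
    {f : X → E → ℝ} (hf : Measurable (Function.uncurry f)) {b : X → ℝ} (hb : ∀ x m, |f x m| ≤ b x)
    (hb2 : MemLp b 2 P) {h : E → ℝ} (hh : Measurable h) {H : ℝ} (hH : ∀ m, |h m| ≤ H)
    (hf0 : ∀ m, ∫ x, f x m ∂P = 0) (hf2 : ∀ m, ∫ x, f x m ^ 2 ∂P ≤ h m)
    {η : ℝ} (hη : 0 < η) :
    ∫ D, ∫ m, f (D i) m ∂(M D) ∂(Measure.pi fun _ => P)
      ≤ 1 / (2 * η) * ∫ D, ∫ m, h m ∂(M D) ∂(Measure.pi fun _ => P) + η / 2 * χ := by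
  set Q : Measure (Fin n → X) := Measure.pi fun _ => P
  have hb0 : ∀ x, 0 ≤ b x := by
    intro x
    by_cases hE : Nonempty E
    · obtain ⟨m⟩ := hE
      exact (abs_nonneg _).trans (hb x m)
    · exfalso
      have : IsProbabilityMeasure (M fun _ => x) := inferInstance
      have hE' : IsEmpty E := not_nonempty_iff.1 hE
      have := this.measure_univ
      simp [Set.univ_eq_empty_iff.2 hE'] at this
  have hbi : Integrable b P := hb2.integrable (by norm_num)
  have hb2i : Integrable (fun x => b x ^ 2) P := hb2.integrable_sq
  have hfx : ∀ x, Measurable (f x) := fun x => hf.of_uncurry_left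
  -- The tested sample `p.2` is kept separate from the dataset `p.1` that produces the output, so
  -- the two are independent under `Q.prod P`.
  set k : (Fin n → X) × X → ℝ := fun p =>
    ∫ m, (f p.2 m + 1 / (2 * η) * f p.2 m ^ 2) ∂(M p.1) with hk
  have hg : Measurable (fun q : X × E => f q.1 q.2 + 1 / (2 * η) * f q.1 q.2 ^ 2) :=
    hf.add ((hf.pow_const 2).const_mul _)
  have hgb : ∀ x m, |f x m + 1 / (2 * η) * f x m ^ 2| ≤ b x + 1 / (2 * η) * b x ^ 2 := by
    intro x m
    refine (abs_add_le _ _).trans (add_le_add (hb x m) ?_)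
    rw [abs_mul, abs_of_pos (by positivity : 0 < 1 / (2 * η)), abs_pow]
    gcongr
    exact hb x m
  have hkm : StronglyMeasurable k := by
    have : StronglyMeasurable (fun q : ((Fin n → X) × X) × E =>
        f q.1.2 q.2 + 1 / (2 * η) * f q.1.2 q.2 ^ 2) :=
      (hg.comp (by fun_prop : Measurable fun q : ((Fin n → X) × X) × E => (q.1.2, q.2))).stronglyMeasurable
    exact this.integral_kernel_prod_right' (κ := M.comap Prod.fst measurable_fst)
  have hkb : ∀ p, |k p| ≤ b p.2 + 1 / (2 * η) * b p.2 ^ 2 := by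
    intro p
    exact abs_integral_le_of_abs_le (hgb p.2)
  have hki : Integrable k (Q.prod P) := by
    refine Integrable.mono' (g := fun p => b p.2 + 1 / (2 * η) * b p.2 ^ 2) ?_
      hkm.aestronglyMeasurable (ae_of_all _ hkb)
    exact (hbi.add (hb2i.const_mul _)).comp_snd Q
  have hφm : StronglyMeasurable (fun D => ∫ m, f (D i) m ∂(M D)) := by
    have : StronglyMeasurable (fun q : (Fin n → X) × E => f (q.1 i) q.2) :=
      (hf.comp (by fun_prop : Measurable fun q : (Fin n → X) × E => (q.1 i, q.2))).stronglyMeasurable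
    exact this.integral_kernel_prod_right' (κ := M)
  have hφi : Integrable (fun D => ∫ m, f (D i) m ∂(M D)) Q := by
    refine Integrable.mono' (g := fun D => b (D i)) ?_ hφm.aestronglyMeasurable
      (ae_of_all _ fun D => ?_)
    · exact (measurePreserving_eval (fun _ => P) i).integrable_comp_of_integrable hbi
    · exact abs_integral_le_of_abs_le (hb (D i))
  have hT := measurePreserving_update_swap P i
  have hstep : ∫ D, ∫ m, f (D i) m ∂(M D) ∂Q ≤ ∫ p, k p ∂(Q.prod P) + η / 2 * χ := by
    have e1 : ∫ D, ∫ m, f (D i) m ∂(M D) ∂Q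
        = ∫ p : (Fin n → X) × X, ∫ m, f (p.1 i) m ∂(M p.1) ∂(Q.prod P) := by
      rw [integral_fun_fst (μ := Q) (ν := P) (fun D : Fin n → X => ∫ m, f (D i) m ∂(M D))]
      simp
    -- By exchangeability, testing the fresh sample against the output on D has the same mean as
    -- testing D i against the output on D with entry i replaced.
    have e2 : ∫ p, k p ∂(Q.prod P)
        = ∫ p : (Fin n → X) × X, k (Function.update p.1 i p.2, p.1 i) ∂(Q.prod P) := by
      conv_lhs => rw [← hT.map_eq]
      rw [integral_map hT.measurable.aemeasurable hkm.aestronglyMeasurable]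
    have hki' : Integrable (fun p : (Fin n → X) × X => k (Function.update p.1 i p.2, p.1 i))
        (Q.prod P) := hT.integrable_comp_of_integrable hki
    have e3 : ∫ p : (Fin n → X) × X, (k (Function.update p.1 i p.2, p.1 i) + η / 2 * χ)
        ∂(Q.prod P) = ∫ p, k p ∂(Q.prod P) + η / 2 * χ := by
      rw [integral_add hki' (integrable_const _), e2]; simp
    rw [e1, ← e3]
    refine integral_mono (hφi.comp_fst P) (hki'.add (integrable_const _)) fun p => ?_
    exact integral_le_of_lintegral_rnDeriv_sq_le (hM p.1 p.2).1 (hM p.1 p.2).2 (hfx _) (hb _) hη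
  refine hstep.trans (add_le_add_left ?_ _)
  rw [integral_prod _ hki, ← integral_const_mul]
  have hhm : StronglyMeasurable (fun D => ∫ m, h m ∂(M D)) :=
    (hh.comp measurable_snd).stronglyMeasurable.integral_kernel_prod_right' (κ := M)
  have hhi : Integrable (fun D => ∫ m, h m ∂(M D)) Q := by
    refine Integrable.of_bound hhm.aestronglyMeasurable H (ae_of_all _ fun D => ?_)
    exact abs_integral_le_of_abs_le hH
  refine integral_mono hki.integral_prod_left (hhi.const_mul _) fun D => ?_
  have hgi : Integrable (fun q : X × E => f q.1 q.2 + 1 / (2 * η) * f q.1 q.2 ^ 2)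
      (P.prod (M D)) := by
    refine Integrable.mono' (g := fun p => b p.1 + 1 / (2 * η) * b p.1 ^ 2) ?_
      hg.aestronglyMeasurable (ae_of_all _ fun q => hgb q.1 q.2)
    exact (hbi.add (hb2i.const_mul _)).comp_fst (M D)
  -- With sample and output independent, the sample is integrated first at fixed output m: the
  -- linear term vanishes and the quadratic one is at most h m.
  have hswap : ∫ x, k (D, x) ∂P
      = ∫ m, ∫ x, (f x m + 1 / (2 * η) * f x m ^ 2) ∂P ∂(M D) :=
    integral_integral_swap (f := fun x m => f x m + 1 / (2 * η) * f x m ^ 2) hgi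
  have hhiM : Integrable h (M D) :=
    Integrable.of_bound hh.aestronglyMeasurable H (ae_of_all _ hH)
  show ∫ x, k (D, x) ∂P ≤ 1 / (2 * η) * ∫ m, h m ∂(M D)
  rw [hswap, ← integral_const_mul]
  refine integral_mono hgi.integral_prod_right (hhiM.const_mul _) fun m => ?_
  have hfm : Measurable fun x => f x m := hf.of_uncurry_right
  have i1 : Integrable (fun x => f x m) P :=
    hbi.mono' hfm.aestronglyMeasurable (ae_of_all _ fun x => hb x m)
  have i2 : Integrable (fun x => f x m ^ 2) P :=
    hb2i.mono' (hfm.pow_const 2).aestronglyMeasurable (ae_of_all _ fun x => by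
      rw [Real.norm_eq_abs, abs_pow]; exact pow_le_pow_left₀ (abs_nonneg _) (hb x m) 2)
  show ∫ x, (f x m + 1 / (2 * η) * f x m ^ 2) ∂P ≤ 1 / (2 * η) * h m
  rw [integral_add i1 (i2.const_mul _), integral_const_mul, hf0, zero_add]
  exact mul_le_mul_of_nonneg_left (hf2 m) (by positivity)

end Soundness

/-! ### Quadratic forms and eigenvalue bounds -/

section QuadraticForm

variable {d : ℕ} {S : Matrix (Fin d) (Fin d) ℝ}

lemma quadraticForm_eq_sum_eigenvalues (hS : S.IsHermitian) (u : EuclideanSpace ℝ (Fin d)) :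
    u ⬝ᵥ S.mulVec u = ∑ i, hS.eigenvalues i * (inner ℝ (hS.eigenvectorBasis i) u) ^ 2 := by
  have h1 : u ⬝ᵥ S.mulVec u = inner ℝ u (Matrix.toEuclideanCLM (𝕜 := ℝ) S u) := by
    rw [Matrix.inner_toEuclideanCLM]
  rw [h1, ← hS.eigenvectorBasis.sum_inner_mul_inner]
  refine Finset.sum_congr rfl fun i _ => ?_
  have h2 : inner ℝ (hS.eigenvectorBasis i) (Matrix.toEuclideanCLM (𝕜 := ℝ) S u)
      = hS.eigenvalues i * inner ℝ (hS.eigenvectorBasis i) u := by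
    have h3 : Matrix.toEuclideanCLM (𝕜 := ℝ) S (hS.eigenvectorBasis i)
        = hS.eigenvalues i • hS.eigenvectorBasis i := by
      ext j
      simpa using congrFun (hS.mulVec_eigenvectorBasis i) j
    have h4 : IsSelfAdjoint (Matrix.toEuclideanCLM (𝕜 := ℝ) S) :=
      IsSelfAdjoint.map (show IsSelfAdjoint S from hS) (Matrix.toEuclideanCLM (𝕜 := ℝ) (n := Fin d))
    rw [← ContinuousLinearMap.adjoint_inner_left, h4.adjoint_eq, h3, real_inner_smul_left]
  rw [h2, real_inner_comm]
  ring

lemma quadraticForm_le (hS : S.IsHermitian) {l : ℝ} (hl : ∀ i, hS.eigenvalues i ≤ l)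
    (u : EuclideanSpace ℝ (Fin d)) : u ⬝ᵥ S.mulVec u ≤ l * ‖u‖ ^ 2 := by
  rw [quadraticForm_eq_sum_eigenvalues hS, ← hS.eigenvectorBasis.sum_sq_inner_right u,
    Finset.mul_sum]
  exact Finset.sum_le_sum fun i _ => mul_le_mul_of_nonneg_right (hl i) (sq_nonneg _)

lemma le_quadraticForm (hS : S.IsHermitian) {l : ℝ} (hl : ∀ i, l ≤ hS.eigenvalues i)
    (u : EuclideanSpace ℝ (Fin d)) : l * ‖u‖ ^ 2 ≤ u ⬝ᵥ S.mulVec u := by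
  rw [quadraticForm_eq_sum_eigenvalues hS, ← hS.eigenvectorBasis.sum_sq_inner_right u,
    Finset.mul_sum]
  exact Finset.sum_le_sum fun i _ => mul_le_mul_of_nonneg_right (hl i) (sq_nonneg _)

end QuadraticForm

/-! ### The Gaussian linear model: risk, score and likelihood ratio -/

section Model

variable {d : ℕ} {S : Matrix (Fin d) (Fin d) ℝ} {ζ : ℝ≥0} {θs : EuclideanSpace ℝ (Fin d)}

lemma memLp_inner_multivariateGaussian (u : EuclideanSpace ℝ (Fin d)) :
    MemLp (fun x => inner ℝ x u) 2 (multivariateGaussian 0 S) := by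
  simp_rw [real_inner_comm u]
  exact (innerSL ℝ u).comp_memLp' (IsGaussian.memLp_two_id (μ := multivariateGaussian 0 S))

lemma integral_inner_multivariateGaussian (u : EuclideanSpace ℝ (Fin d)) :
    ∫ x, inner ℝ x u ∂(multivariateGaussian 0 S) = 0 := by
  simp_rw [real_inner_comm u]
  have := (innerSL ℝ u).integral_comp_comm
    (IsGaussian.integrable_id (μ := multivariateGaussian (0 : EuclideanSpace ℝ (Fin d)) S))
  simpa using this

lemma integral_inner_sq_multivariateGaussian (hS : S.PosSemidef) (u : EuclideanSpace ℝ (Fin d)) :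
    ∫ x, (inner ℝ x u : ℝ) ^ 2 ∂(multivariateGaussian 0 S) = u ⬝ᵥ S.mulVec u := by
  rw [← covarianceBilin_multivariateGaussian (μ := 0) hS, covarianceBilin_apply
    IsGaussian.memLp_two_id]
  simp [pow_two, real_inner_comm u]

instance isProbabilityMeasure_sampleLaw : IsProbabilityMeasure (sampleLaw S ζ θs) :=
  Measure.isProbabilityMeasure_map (by fun_prop)

instance isProbabilityMeasure_dataLaw {n : ℕ} : IsProbabilityMeasure (dataLaw n S ζ θs) := by
  unfold dataLaw; infer_instance

lemma integral_sampleLaw {f : Sample d → ℝ} (hf : Measurable f) :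
    ∫ p, f p ∂(sampleLaw S ζ θs) = ∫ p : EuclideanSpace ℝ (Fin d) × ℝ,
      f (p.1, inner ℝ p.1 θs + p.2) ∂((multivariateGaussian 0 S).prod (gaussianReal 0 (ζ ^ 2))) := by
  rw [sampleLaw, integral_map (by fun_prop) hf.aestronglyMeasurable]

lemma integral_sq_gaussianReal_zero (v : ℝ≥0) : ∫ z, z ^ 2 ∂(gaussianReal 0 v) = v := by
  have h := variance_fun_id_gaussianReal (μ := 0) (v := v)
  rw [variance_eq_sub (X := fun x : ℝ => x) (memLp_id_gaussianReal 2)] at h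
  simpa using h

/-- The residual is ⟨x, θ - θs⟩ - z. Its cross term integrates to zero, x being centred and
independent of z, and the noise variance is exactly what the definition subtracts. -/
lemma excessRisk_eq (hS : S.PosSemidef) (θ : EuclideanSpace ℝ (Fin d)) :
    excessRisk S ζ θs θ = 1 / 2 * ((θ - θs) ⬝ᵥ S.mulVec (θ - θs)) := by
  have hx := memLp_inner_multivariateGaussian (S := S) (θ - θs)
  have hz : MemLp (fun z : ℝ => z) 2 (gaussianReal 0 (ζ ^ 2)) := memLp_id_gaussianReal 2
  have hi1 := hx.integrable_sq.comp_fst (gaussianReal 0 (ζ ^ 2))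
  have hi2 := hz.integrable_sq.comp_snd (multivariateGaussian (0 : EuclideanSpace ℝ (Fin d)) S)
  have hi3 := (hx.integrable (by norm_num)).mul_prod (hz.integrable (by norm_num))
  rw [excessRisk, testRisk, integral_sampleLaw (by fun_prop)]
  have : ∀ p : EuclideanSpace ℝ (Fin d) × ℝ,
      (inner ℝ p.1 θ - (inner ℝ p.1 θs + p.2)) ^ 2
      = ((inner ℝ p.1 (θ - θs)) ^ 2 - 2 * (inner ℝ p.1 (θ - θs) * p.2)) + p.2 ^ 2 := by
    intro p; rw [inner_sub_right]; ring
  simp_rw [this]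
  have i12 : Integrable (fun p : EuclideanSpace ℝ (Fin d) × ℝ => (inner ℝ p.1 (θ - θs)) ^ 2 -
      2 * (inner ℝ p.1 (θ - θs) * p.2)) ((multivariateGaussian 0 S).prod (gaussianReal 0 (ζ ^ 2))) :=
    hi1.sub (hi3.const_mul 2)
  rw [integral_add i12 hi2, integral_sub hi1 (hi3.const_mul 2), integral_const_mul,
    integral_fun_fst (fun x : EuclideanSpace ℝ (Fin d) => (inner ℝ x (θ - θs) : ℝ) ^ 2),
    integral_fun_snd (fun z : ℝ => z ^ 2),
    integral_prod_mul (fun x : EuclideanSpace ℝ (Fin d) => (inner ℝ x (θ - θs) : ℝ)) (fun z : ℝ => z),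
    integral_inner_multivariateGaussian, integral_inner_sq_multivariateGaussian hS,
    integral_sq_gaussianReal_zero]
  simp
  ring

/-- The `j`-th partial derivative of the log-likelihood of one sample. -/
def score (v : ℝ) (θ : EuclideanSpace ℝ (Fin d)) (p : Sample d) (j : Fin d) : ℝ :=
  p.1 j * (p.2 - inner ℝ p.1 θ) / v

@[fun_prop]
lemma measurable_score {v : ℝ} {j : Fin d} {θ : EuclideanSpace ℝ (Fin d)} :
    Measurable fun p : Sample d => score v θ p j := by
  unfold score; fun_prop

/-- At the true parameter the residual is z, so the combination equals ⟨x, u⟩ z / v, a product of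
independent square-integrable factors. The mean and second moment below come from the same
factorisation. -/
lemma memLp_combination_score (v : ℝ) (u : EuclideanSpace ℝ (Fin d)) :
    MemLp (fun p => ∑ j, u j * score v θs p j) 2 (sampleLaw S ζ θs) := by
  rw [memLp_two_iff_integrable_sq (Measurable.aestronglyMeasurable (by fun_prop)), sampleLaw,
    integrable_map_measure (Measurable.aestronglyMeasurable (by fun_prop)) (by fun_prop)]
  have hx := memLp_inner_multivariateGaussian (S := S) u
  have hz : MemLp (fun z : ℝ => z) 2 (gaussianReal 0 (ζ ^ 2)) := memLp_id_gaussianReal 2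
  convert (hx.integrable_sq.mul_prod hz.integrable_sq).const_mul (v⁻¹ ^ 2) using 2 with p
  simp only [Function.comp, score, PiLp.inner_apply, RCLike.inner_apply, conj_trivial]
  rw [← mul_pow, ← mul_pow, Finset.sum_mul, Finset.mul_sum]
  congr 1
  refine Finset.sum_congr rfl fun j _ => ?_
  ring

lemma integral_combination_score (v : ℝ) (u : EuclideanSpace ℝ (Fin d)) :
    ∫ p, ∑ j, u j * score v θs p j ∂(sampleLaw S ζ θs) = 0 := by
  rw [integral_sampleLaw (by fun_prop)]
  have : ∀ p : EuclideanSpace ℝ (Fin d) × ℝ,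
      ∑ j, u j * score v θs (p.1, inner ℝ p.1 θs + p.2) j = (inner ℝ p.1 u : ℝ) * (p.2 / v) := by
    intro p
    simp only [score, add_sub_cancel_left, PiLp.inner_apply p.1 u,
      RCLike.inner_apply, conj_trivial, Finset.sum_mul]
    exact Finset.sum_congr rfl fun j _ => by ring
  simp_rw [this]
  rw [integral_prod_mul (fun x : EuclideanSpace ℝ (Fin d) => (inner ℝ x u : ℝ)) (fun z : ℝ => z / v),
    integral_inner_multivariateGaussian, zero_mul]

lemma integral_combination_score_sq (hS : S.PosSemidef)
    (u : EuclideanSpace ℝ (Fin d)) :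
    ∫ p, (∑ j, u j * score ((ζ : ℝ) ^ 2) θs p j) ^ 2 ∂(sampleLaw S ζ θs)
      = u ⬝ᵥ S.mulVec u / (ζ : ℝ) ^ 2 := by
  rw [integral_sampleLaw (by fun_prop)]
  have : ∀ p : EuclideanSpace ℝ (Fin d) × ℝ,
      (∑ j, u j * score ((ζ : ℝ) ^ 2) θs (p.1, inner ℝ p.1 θs + p.2) j) ^ 2
        = (inner ℝ p.1 u : ℝ) ^ 2 * (p.2 ^ 2 / ((ζ : ℝ) ^ 2) ^ 2) := by
    intro p
    rw [← div_pow, ← mul_pow]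
    congr 1
    simp only [score, add_sub_cancel_left, PiLp.inner_apply p.1 u,
      RCLike.inner_apply, conj_trivial, Finset.sum_mul]
    exact Finset.sum_congr rfl fun j _ => by ring
  simp_rw [this]
  rw [integral_prod_mul (fun x : EuclideanSpace ℝ (Fin d) => (inner ℝ x u : ℝ) ^ 2)
    (fun z : ℝ => z ^ 2 / ((ζ : ℝ) ^ 2) ^ 2),
    integral_inner_sq_multivariateGaussian hS, integral_div, integral_sq_gaussianReal_zero]
  push_cast
  field_simp

lemma sum_single_mul_score (v : ℝ) (θ : EuclideanSpace ℝ (Fin d)) (p : Sample d) (j : Fin d) :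
    ∑ k, EuclideanSpace.single j (1 : ℝ) k * score v θ p k = score v θ p j := by
  simp

lemma memLp_score (v : ℝ) (j : Fin d) :
    MemLp (fun p => score v θs p j) 2 (sampleLaw S ζ θs) := by
  simpa only [sum_single_mul_score] using
    memLp_combination_score (S := S) (ζ := ζ) (θs := θs) v (EuclideanSpace.single j 1)

lemma integral_score (v : ℝ) (j : Fin d) : ∫ p, score v θs p j ∂(sampleLaw S ζ θs) = 0 := by
  simpa only [sum_single_mul_score] using
    integral_combination_score (S := S) (ζ := ζ) (θs := θs) v (EuclideanSpace.single j 1)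

lemma integral_score_sq (hS : S.PosSemidef) (j : Fin d) :
    ∫ p, score ((ζ : ℝ) ^ 2) θs p j ^ 2 ∂(sampleLaw S ζ θs) = S j j / (ζ : ℝ) ^ 2 := by
  have := integral_combination_score_sq (ζ := ζ) (θs := θs) hS (EuclideanSpace.single j 1)
  simp only [sum_single_mul_score] at this
  simpa using this

/-- Likelihood ratio of one sample between the parameters `θ` and `0`. -/
def likelihoodRatio (v : ℝ) (θ : EuclideanSpace ℝ (Fin d)) (p : Sample d) : ℝ :=
  Real.exp ((inner ℝ p.1 θ * p.2 - inner ℝ p.1 θ ^ 2 / 2) / v)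

lemma likelihoodRatio_pos (v : ℝ) (θ : EuclideanSpace ℝ (Fin d)) (p : Sample d) :
    0 < likelihoodRatio v θ p := Real.exp_pos _

lemma gaussianReal_eq_withDensity (m : ℝ) {v : ℝ≥0} (hv : v ≠ 0) :
    gaussianReal m v = (gaussianReal 0 v).withDensity
      fun y => ENNReal.ofReal (Real.exp ((m * y - m ^ 2 / 2) / v)) := by
  rw [gaussianReal_of_var_ne_zero _ hv, gaussianReal_of_var_ne_zero _ hv,
    ← withDensity_mul _ (measurable_gaussianPDF _ _) (by fun_prop)]
  congr 1
  ext y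
  simp only [Pi.mul_apply, gaussianPDF, gaussianPDFReal]
  rw [← ENNReal.ofReal_mul (by positivity), mul_assoc (√(2 * Real.pi * v))⁻¹, ← Real.exp_add]
  congr 3
  have : (v : ℝ) ≠ 0 := by exact_mod_cast hv
  field_simp
  ring

lemma lintegral_sampleLaw {f : Sample d → ℝ≥0∞} (hf : Measurable f) :
    ∫⁻ p, f p ∂(sampleLaw S ζ θs) = ∫⁻ x : EuclideanSpace ℝ (Fin d),
      ∫⁻ y, f (x, y) ∂(gaussianReal (inner ℝ x θs) (ζ ^ 2)) ∂(multivariateGaussian 0 S) := by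
  rw [sampleLaw, lintegral_map hf (by fun_prop), lintegral_prod _ (by fun_prop)]
  refine lintegral_congr fun x => ?_
  have := gaussianReal_map_const_add (μ := 0) (v := ζ ^ 2) (inner ℝ x θs)
  rw [zero_add] at this
  rw [← this, lintegral_map (by fun_prop) (by fun_prop)]

/-- The law of x does not involve the parameter, so only the conditional Gaussian law of y given x
contributes to the ratio. -/
lemma sampleLaw_eq_withDensity (hζ : ζ ≠ 0) :
    sampleLaw S ζ θs = (sampleLaw S ζ 0).withDensity
      fun p => ENNReal.ofReal (likelihoodRatio ((ζ : ℝ) ^ 2) θs p) := by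
  have hm : Measurable fun p : Sample d =>
      ENNReal.ofReal (likelihoodRatio ((ζ : ℝ) ^ 2) θs p) := by
    unfold likelihoodRatio; fun_prop
  refine Measure.ext_of_lintegral _ fun f hf => ?_
  rw [lintegral_withDensity_eq_lintegral_mul _ hm hf, lintegral_sampleLaw hf,
    lintegral_sampleLaw (hm.mul hf)]
  refine lintegral_congr fun x => ?_
  rw [gaussianReal_eq_withDensity _ (pow_ne_zero 2 hζ), inner_zero_right,
    lintegral_withDensity_eq_lintegral_mul _ (by fun_prop) (by fun_prop)]
  simp [likelihoodRatio]

end Model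

/-! ### Density of the data law relative to parameter 0 -/

lemma pi_withDensity {ι X : Type*} [Fintype ι] [MeasurableSpace X] (P : Measure X)
    [IsProbabilityMeasure P] {f : X → ℝ≥0∞} (hf : Measurable f)
    [IsProbabilityMeasure (P.withDensity f)] :
    (Measure.pi fun _ : ι => P.withDensity f)
      = (Measure.pi fun _ : ι => P).withDensity fun D => ∏ i, f (D i) := by
  refine Measure.pi_eq fun s hs => ?_
  rw [withDensity_apply _ (MeasurableSet.univ_pi hs), ← lintegral_indicator (MeasurableSet.univ_pi hs)]
  have hind : ∀ D : ι → X, (Set.univ.pi s).indicator (fun D => ∏ i, f (D i)) D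
      = ∏ i, (s i).indicator f (D i) := by
    intro D
    by_cases h : D ∈ Set.univ.pi s
    · rw [Set.indicator_of_mem h]
      exact Finset.prod_congr rfl fun i _ => (Set.indicator_of_mem (h i (Set.mem_univ i)) f).symm
    · rw [Set.indicator_of_notMem h]
      simp only [Set.mem_pi, Set.mem_univ, true_implies, not_forall] at h
      obtain ⟨i, hi⟩ := h
      exact (Finset.prod_eq_zero (Finset.mem_univ i) (Set.indicator_of_notMem hi f)).symm
  simp_rw [hind]
  have hg : ∀ i, Measurable ((s i).indicator f) := fun i => hf.indicator (hs i)
  have hindep : iIndepFun (fun i (D : ι → X) => (s i).indicator f (D i)) (Measure.pi fun _ => P) :=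
    iIndepFun_pi (X := fun i => (s i).indicator f) fun i => (hg i).aemeasurable
  rw [lintegral_prod_eq_prod_lintegral_of_indepFun Finset.univ _ hindep (fun i => by fun_prop)]
  refine Finset.prod_congr rfl fun i _ => ?_
  rw [withDensity_apply _ (hs i), ← lintegral_indicator (hs i)]
  exact (measurePreserving_eval (fun _ : ι => P) i).lintegral_comp (hg i)

/-- A reference measure free of θs moves all dependence on the parameter into the integrand, where
it can be differentiated and integrated over the prior. -/
lemma dataLaw_eq_withDensity (n : ℕ) {d : ℕ} (S : Matrix (Fin d) (Fin d) ℝ) {ζ : ℝ≥0} (hζ : ζ ≠ 0)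
    (θs : EuclideanSpace ℝ (Fin d)) :
    dataLaw n S ζ θs = (dataLaw n S ζ 0).withDensity
      fun D => ENNReal.ofReal (∏ i, likelihoodRatio ((ζ : ℝ) ^ 2) θs (D i)) := by
  have hm : Measurable fun p : Sample d =>
      ENNReal.ofReal (likelihoodRatio ((ζ : ℝ) ^ 2) θs p) := by
    unfold likelihoodRatio; fun_prop
  have hP : IsProbabilityMeasure ((sampleLaw S ζ 0).withDensity fun p =>
      ENNReal.ofReal (likelihoodRatio ((ζ : ℝ) ^ 2) θs p)) := by
    rw [← sampleLaw_eq_withDensity hζ]; infer_instance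
  have : dataLaw n S ζ θs = Measure.pi fun _ => (sampleLaw S ζ 0).withDensity
      fun p => ENNReal.ofReal (likelihoodRatio ((ζ : ℝ) ^ 2) θs p) := by
    unfold dataLaw; rw [sampleLaw_eq_withDensity hζ]
  rw [this, pi_withDensity _ hm]
  congr 1
  ext D
  exact (ENNReal.ofReal_prod_of_nonneg fun i _ => (likelihoodRatio_pos _ _ _).le).symm

lemma integral_dataLaw {n d : ℕ} {S : Matrix (Fin d) (Fin d) ℝ} {ζ : ℝ≥0} (hζ : ζ ≠ 0)
    (θs : EuclideanSpace ℝ (Fin d)) (g : Dataset n d → ℝ) :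
    ∫ D, g D ∂(dataLaw n S ζ θs)
      = ∫ D, (∏ i, likelihoodRatio ((ζ : ℝ) ^ 2) θs (D i)) * g D ∂(dataLaw n S ζ 0) := by
  rw [dataLaw_eq_withDensity n S hζ, integral_withDensity_eq_integral_toReal_smul
    (by unfold likelihoodRatio; fun_prop) (ae_of_all _ fun _ => ENNReal.ofReal_lt_top)]
  refine integral_congr_ae (ae_of_all _ fun D => ?_)
  simp only [smul_eq_mul]
  rw [ENNReal.toReal_ofReal (Finset.prod_nonneg fun i _ => (likelihoodRatio_pos _ _ _).le)]

lemma integrable_dataLaw_iff {n d : ℕ} {S : Matrix (Fin d) (Fin d) ℝ} {ζ : ℝ≥0} (hζ : ζ ≠ 0)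
    (θs : EuclideanSpace ℝ (Fin d)) (g : Dataset n d → ℝ) :
    Integrable g (dataLaw n S ζ θs) ↔
      Integrable (fun D => (∏ i, likelihoodRatio ((ζ : ℝ) ^ 2) θs (D i)) * g D)
        (dataLaw n S ζ 0) := by
  rw [dataLaw_eq_withDensity n S hζ, integrable_withDensity_iff_integrable_smul'
    (by unfold likelihoodRatio; fun_prop) (ae_of_all _ fun _ => ENNReal.ofReal_lt_top)]
  refine integrable_congr (ae_of_all _ fun D => ?_)
  simp only [smul_eq_mul]
  rw [ENNReal.toReal_ofReal (Finset.prod_nonneg fun i _ => (likelihoodRatio_pos _ _ _).le)]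

/-! ### The uniform prior -/

/-- Uniform distribution on `[-a, a]`. -/
def uniformInterval (a : ℝ) : Measure ℝ := ProbabilityTheory.cond volume (Set.Icc (-a) a)

lemma isProbabilityMeasure_uniformInterval {a : ℝ} (ha : 0 < a) :
    IsProbabilityMeasure (uniformInterval a) := by
  apply cond_isProbabilityMeasure_of_finite <;> simp [ha]

lemma integral_uniformInterval {a : ℝ} (ha : 0 < a) (f : ℝ → ℝ) :
    ∫ t, f t ∂(uniformInterval a) = (2 * a)⁻¹ * ∫ t in (-a)..a, f t := by
  rw [uniformInterval, ProbabilityTheory.cond, integral_smul_measure,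
    intervalIntegral.integral_of_le (by linarith), integral_Icc_eq_integral_Ioc, Real.volume_Icc,
    ENNReal.toReal_inv, ENNReal.toReal_ofReal (by linarith), smul_eq_mul]
  congr 2
  ring

lemma integral_sq_uniformInterval {a : ℝ} (ha : 0 < a) :
    ∫ t, t ^ 2 ∂(uniformInterval a) = a ^ 2 / 3 := by
  rw [integral_uniformInterval ha, integral_pow]
  field_simp
  norm_num
  ring

lemma ae_uniformInterval (a : ℝ) : ∀ᵐ t ∂(uniformInterval a), |t| ≤ a := by
  filter_upwards [ae_cond_mem (μ := volume) (measurableSet_Icc (a := -a) (b := a))] with t ht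
  exact abs_le.2 ht

/-- Uniform distribution on the cube `[-a, a]ᵈ`. -/
def uniformCube (d : ℕ) (a : ℝ) : Measure (Fin d → ℝ) := Measure.pi fun _ => uniformInterval a

lemma isProbabilityMeasure_uniformCube (d : ℕ) {a : ℝ} (ha : 0 < a) :
    IsProbabilityMeasure (uniformCube d a) := by
  have := isProbabilityMeasure_uniformInterval ha
  unfold uniformCube; infer_instance

lemma ae_uniformCube (d : ℕ) {a : ℝ} (ha : 0 < a) :
    ∀ᵐ ϑ ∂(uniformCube d a), ∀ j, |ϑ j| ≤ a := by
  have := isProbabilityMeasure_uniformInterval ha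
  rw [ae_all_iff]
  intro j
  exact (measurePreserving_eval (fun _ : Fin d => uniformInterval a) j).quasiMeasurePreserving.ae
    (ae_uniformInterval a)

lemma integral_sq_uniformCube (d : ℕ) {a : ℝ} (ha : 0 < a) (j : Fin d) :
    ∫ ϑ, ϑ j ^ 2 ∂(uniformCube d a) = a ^ 2 / 3 := by
  have := isProbabilityMeasure_uniformInterval ha
  have hp := measurePreserving_eval (fun _ : Fin d => uniformInterval a) j
  rw [← integral_sq_uniformInterval ha, ← hp.map_eq,
    integral_map hp.measurable.aemeasurable (by fun_prop)]
  rfl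

/-! ### Integration by parts against the prior -/

section IntegrationByParts

variable {n d : ℕ}

/-- Likelihood ratio of a dataset between the parameters `ϑ` and `0`. -/
def dataLikelihoodRatio (v : ℝ) (ϑ : Fin d → ℝ) (D : Dataset n d) : ℝ :=
  ∏ i, likelihoodRatio v (WithLp.toLp 2 ϑ) (D i)

lemma dataLikelihoodRatio_eq_exp (v : ℝ) (ϑ : Fin d → ℝ) (D : Dataset n d) :
    dataLikelihoodRatio v ϑ D = Real.exp (∑ i, (inner ℝ (D i).1 (WithLp.toLp 2 ϑ) * (D i).2
      - inner ℝ (D i).1 (WithLp.toLp 2 ϑ) ^ 2 / 2) / v) := by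
  simp only [dataLikelihoodRatio, likelihoodRatio, Real.exp_sum]

lemma inner_update (x : EuclideanSpace ℝ (Fin d)) (ϑ : Fin d → ℝ) (j : Fin d) (t : ℝ) :
    inner ℝ x (WithLp.toLp 2 (Function.update ϑ j t))
      = inner ℝ x (WithLp.toLp 2 ϑ) + x j * (t - ϑ j) := by
  have : WithLp.toLp 2 (Function.update ϑ j t)
      = WithLp.toLp 2 ϑ + EuclideanSpace.single j (t - ϑ j) := by
    ext k
    by_cases h : k = j
    · subst h; simp
    · simp [h]
  rw [this, inner_add_right, EuclideanSpace.inner_single_right]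
  simp [mul_comm]

/-- Moving one coordinate changes each inner product affinely, so the log-likelihood is quadratic in
t and differentiates to the sum of the scores. -/
lemma hasDerivAt_dataLikelihoodRatio (v : ℝ) (ϑ : Fin d → ℝ) (j : Fin d) (D : Dataset n d) (t : ℝ) :
    HasDerivAt (fun t => dataLikelihoodRatio v (Function.update ϑ j t) D)
      (dataLikelihoodRatio v (Function.update ϑ j t) D *
        ∑ i, score v (WithLp.toLp 2 (Function.update ϑ j t)) (D i) j) t := by
  simp only [dataLikelihoodRatio_eq_exp, score, inner_update]
  refine HasDerivAt.exp (HasDerivAt.fun_sum fun i _ => ?_)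
  have h1 : HasDerivAt (fun t => inner ℝ (D i).1 (WithLp.toLp 2 ϑ) + (D i).1 j * (t - ϑ j))
      ((D i).1 j) t := by
    simpa using (((hasDerivAt_id t).sub_const (ϑ j)).const_mul ((D i).1 j)).const_add
      (inner ℝ (D i).1 (WithLp.toLp 2 ϑ))
  refine (((h1.mul_const (D i).2).fun_sub ((h1.fun_pow 2).div_const 2)).div_const v).congr_deriv ?_
  push_cast
  ring

/-- The derivative in `ϑ j` of the weighted likelihood ratio `(a² - ϑⱼ²) L(ϑ)`. -/
def weightedScore (v a : ℝ) (j : Fin d) (ϑ : Fin d → ℝ) (D : Dataset n d) : ℝ :=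
  (a ^ 2 - ϑ j ^ 2) * ∑ i, score v (WithLp.toLp 2 ϑ) (D i) j - 2 * ϑ j

/-- The integrand is the derivative of (a² - t²) L, and the weight a² - t² removes both boundary
terms. -/
lemma integral_interval_weightedScore (v a : ℝ) (j : Fin d) (ϑ : Fin d → ℝ) (D : Dataset n d) :
    ∫ t in (-a)..a, dataLikelihoodRatio v (Function.update ϑ j t) D *
      weightedScore v a j (Function.update ϑ j t) D = 0 := by
  have hd : ∀ t : ℝ, HasDerivAt
      (fun t => (a ^ 2 - t ^ 2) * dataLikelihoodRatio v (Function.update ϑ j t) D)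
      (dataLikelihoodRatio v (Function.update ϑ j t) D *
        weightedScore v a j (Function.update ϑ j t) D) t := by
    intro t
    have h1 : HasDerivAt (fun t : ℝ => a ^ 2 - t ^ 2) (-(2 * t)) t := by
      refine ((hasDerivAt_pow 2 t).const_sub (a ^ 2)).congr_deriv ?_
      norm_num
    refine (h1.fun_mul (hasDerivAt_dataLikelihoodRatio v ϑ j D t)).congr_deriv ?_
    simp only [weightedScore, Function.update_self]
    ring
  have hc : Continuous fun t => dataLikelihoodRatio v (Function.update ϑ j t) D *
      weightedScore v a j (Function.update ϑ j t) D := by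
    simp only [weightedScore, Function.update_self, dataLikelihoodRatio_eq_exp, score, inner_update]
    fun_prop
  rw [intervalIntegral.integral_eq_sub_of_hasDerivAt (fun t _ => hd t)
    (hc.intervalIntegrable _ _)]
  ring

lemma measurable_weightedScore (v a : ℝ) (j : Fin d) :
    Measurable fun p : (Fin d → ℝ) × Dataset n d => weightedScore v a j p.1 p.2 := by
  unfold weightedScore score; fun_prop

lemma measurable_dataLikelihoodRatio (v : ℝ) :
    Measurable fun p : (Fin d → ℝ) × Dataset n d => dataLikelihoodRatio v p.1 p.2 := by
  unfold dataLikelihoodRatio likelihoodRatio; fun_prop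

variable {S : Matrix (Fin d) (Fin d) ℝ} {ζ : ℝ≥0}

lemma integrable_abs_sum_score (v : ℝ) (θ : EuclideanSpace ℝ (Fin d)) (j : Fin d) :
    Integrable (fun D : Dataset n d => ∑ i, |score v θ (D i) j|) (dataLaw n S ζ θ) := by
  refine integrable_finsetSum _ fun i _ => ?_
  exact (measurePreserving_eval (fun _ : Fin n => sampleLaw S ζ θ) i).integrable_comp_of_integrable
    ((memLp_score v j).integrable (by norm_num)).abs

/-- From |s| ≤ 1 + s². The bound is uniform in θ, as needed for Fubini over prior and data. -/
lemma integral_abs_sum_score_le (hS : S.PosSemidef) (θ : EuclideanSpace ℝ (Fin d)) (j : Fin d) :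
    ∫ D : Dataset n d, ∑ i, |score ((ζ : ℝ) ^ 2) θ (D i) j| ∂(dataLaw n S ζ θ)
      ≤ n * (1 + S j j / (ζ : ℝ) ^ 2) := by
  have hi : Integrable (fun p => |score ((ζ : ℝ) ^ 2) θ p j|) (sampleLaw S ζ θ) :=
    ((memLp_score _ j).integrable (by norm_num)).abs
  have he : ∀ i : Fin n, MeasurePreserving (fun D : Dataset n d => D i) (dataLaw n S ζ θ)
    (sampleLaw S ζ θ) := measurePreserving_eval (fun _ : Fin n => sampleLaw S ζ θ)
  have hc : ∀ i : Fin n, Integrable (fun D : Dataset n d => |score ((ζ : ℝ) ^ 2) θ (D i) j|)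
      (dataLaw n S ζ θ) := fun i => (he i).integrable_comp_of_integrable hi
  rw [integral_finsetSum _ fun i _ => hc i]
  have h1 : ∀ i : Fin n, ∫ D, |score ((ζ : ℝ) ^ 2) θ (D i) j| ∂(dataLaw n S ζ θ)
      = ∫ p, |score ((ζ : ℝ) ^ 2) θ p j| ∂(sampleLaw S ζ θ) := fun i => by
    conv_rhs => rw [← (he i).map_eq, integral_map (he i).measurable.aemeasurable (by fun_prop)]
  have hsq : Integrable (fun p => score ((ζ : ℝ) ^ 2) θ p j ^ 2) (sampleLaw S ζ θ) :=
    (memLp_score _ j).integrable_sq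
  have h2 : ∫ p, |score ((ζ : ℝ) ^ 2) θ p j| ∂(sampleLaw S ζ θ) ≤ 1 + S j j / (ζ : ℝ) ^ 2 := by
    rw [← integral_score_sq (θs := θ) hS j]
    have : ∫ p, (1 + score ((ζ : ℝ) ^ 2) θ p j ^ 2) ∂(sampleLaw S ζ θ)
        = 1 + ∫ p, score ((ζ : ℝ) ^ 2) θ p j ^ 2 ∂(sampleLaw S ζ θ) := by
      rw [integral_add (integrable_const _) hsq]; simp
    rw [← this]
    refine integral_mono hi ((integrable_const _).add hsq) fun p => ?_
    rw [← sq_abs (score ((ζ : ℝ) ^ 2) θ p j)]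
    nlinarith [sq_nonneg (|score ((ζ : ℝ) ^ 2) θ p j| - 1), abs_nonneg (score ((ζ : ℝ) ^ 2) θ p j)]
  simp_rw [h1]
  rw [Finset.sum_const, Finset.card_univ, Fintype.card_fin, nsmul_eq_mul]
  exact mul_le_mul_of_nonneg_left h2 (Nat.cast_nonneg n)

lemma abs_weightedScore_le {v a : ℝ} {j : Fin d} {ϑ : Fin d → ℝ} (hϑ : |ϑ j| ≤ a)
    (D : Dataset n d) :
    |weightedScore v a j ϑ D| ≤ a ^ 2 * ∑ i, |score v (WithLp.toLp 2 ϑ) (D i) j| + 2 * a := by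
  have h0 : ϑ j ^ 2 ≤ a ^ 2 := sq_le_sq' (abs_le.1 hϑ).1 (abs_le.1 hϑ).2
  refine (abs_sub _ _).trans (add_le_add ?_ ?_)
  · rw [abs_mul, abs_of_nonneg (by linarith)]
    exact mul_le_mul (by nlinarith [sq_nonneg (ϑ j)]) (Finset.abs_sum_le_sum_abs _ _) (abs_nonneg _) (sq_nonneg a)
  · rw [abs_mul]; norm_num; exact hϑ

lemma integrable_mul_weightedScore (v : ℝ) {a : ℝ} {j : Fin d} {ϑ : Fin d → ℝ} (hϑ : |ϑ j| ≤ a)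
    {g : Dataset n d → ℝ} (hg : Measurable g) {b : ℝ} (hb : ∀ D, |g D| ≤ b) :
    Integrable (fun D => g D * weightedScore v a j ϑ D) (dataLaw n S ζ (WithLp.toLp 2 ϑ)) := by
  have hw : Integrable (fun D : Dataset n d => weightedScore v a j ϑ D)
      (dataLaw n S ζ (WithLp.toLp 2 ϑ)) :=
    Integrable.mono' (((integrable_abs_sum_score v _ j).const_mul (a ^ 2)).add
      (integrable_const (2 * a)))
      ((measurable_weightedScore v a j).comp (by fun_prop : Measurable fun D => (ϑ, D))).aestronglyMeasurable
      (ae_of_all _ fun D => abs_weightedScore_le hϑ D)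
  exact hw.bdd_mul (c := b) hg.aestronglyMeasurable (ae_of_all _ hb)

/-- Averaged score identity for the uniform prior on a cube. -/
lemma integral_uniformCube_weightedScore (hS : S.PosSemidef) (hζ : ζ ≠ 0) {a : ℝ} (ha : 0 < a)
    (j : Fin d) {g : Dataset n d → ℝ} (hg : Measurable g) {b : ℝ} (hb : ∀ D, |g D| ≤ b) :
    Integrable (fun ϑ => ∫ D, g D * weightedScore ((ζ : ℝ) ^ 2) a j ϑ D
        ∂(dataLaw n S ζ (WithLp.toLp 2 ϑ))) (uniformCube d a) ∧
    ∫ ϑ, ∫ D, g D * weightedScore ((ζ : ℝ) ^ 2) a j ϑ D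
        ∂(dataLaw n S ζ (WithLp.toLp 2 ϑ)) ∂(uniformCube d a) = 0 := by
  have hpi := isProbabilityMeasure_uniformInterval ha
  have hpc := isProbabilityMeasure_uniformCube d ha
  set v : ℝ := (ζ : ℝ) ^ 2
  set Q := dataLaw n S ζ 0
  set k : (Fin d → ℝ) × Dataset n d → ℝ := fun p =>
    dataLikelihoodRatio v p.1 p.2 * (g p.2 * weightedScore v a j p.1 p.2) with hk
  have hF : ∀ ϑ : Fin d → ℝ, ∫ D, g D * weightedScore v a j ϑ D
      ∂(dataLaw n S ζ (WithLp.toLp 2 ϑ)) = ∫ D, k (ϑ, D) ∂Q := fun ϑ =>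
    integral_dataLaw hζ (WithLp.toLp 2 ϑ) _
  have hkm : Measurable k := (measurable_dataLikelihoodRatio v).mul
    ((hg.comp measurable_snd).mul (measurable_weightedScore v a j))
  have hki : Integrable k ((uniformCube d a).prod Q) := by
    rw [integrable_prod_iff hkm.aestronglyMeasurable]
    constructor
    · filter_upwards [ae_uniformCube d ha] with ϑ hϑ
      exact (integrable_dataLaw_iff hζ (WithLp.toLp 2 ϑ) _).1
        (integrable_mul_weightedScore v (hϑ j) hg hb)
    · refine Integrable.of_bound
        (StronglyMeasurable.integral_prod_right (ν := Q) (E := ℝ) (f := fun ϑ D => ‖k (ϑ, D)‖)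
          hkm.stronglyMeasurable.norm).aestronglyMeasurable
        (b * (a ^ 2 * (n * (1 + S j j / v)) + 2 * a)) ?_
      filter_upwards [ae_uniformCube d ha] with ϑ hϑ
      have hL : ∀ D : Dataset n d, 0 ≤ dataLikelihoodRatio v ϑ D := fun D => by
        rw [dataLikelihoodRatio_eq_exp]; exact (Real.exp_pos _).le
      have e : ∫ D, ‖k (ϑ, D)‖ ∂Q
          = ∫ D, |g D * weightedScore v a j ϑ D| ∂(dataLaw n S ζ (WithLp.toLp 2 ϑ)) := by
        rw [integral_dataLaw hζ (WithLp.toLp 2 ϑ)]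
        refine integral_congr_ae (ae_of_all _ fun D => ?_)
        simp only [hk, norm_mul, Real.norm_eq_abs, abs_mul, abs_of_nonneg (hL D)]
        rfl
      rw [e, Real.norm_eq_abs, abs_of_nonneg (integral_nonneg fun _ => abs_nonneg _)]
      have hb0 : 0 ≤ b := (abs_nonneg _).trans (hb 0)
      have hsum := integrable_abs_sum_score (n := n) (S := S) (ζ := ζ) v (WithLp.toLp 2 ϑ) j
      calc ∫ D, |g D * weightedScore v a j ϑ D| ∂(dataLaw n S ζ (WithLp.toLp 2 ϑ))
          ≤ ∫ D, b * (a ^ 2 * ∑ i, |score v (WithLp.toLp 2 ϑ) (D i) j| + 2 * a)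
              ∂(dataLaw n S ζ (WithLp.toLp 2 ϑ)) := by
            refine integral_mono (integrable_mul_weightedScore v (hϑ j) hg hb).abs
              (((hsum.const_mul _).add (integrable_const _)).const_mul b) fun D => ?_
            simp only [abs_mul]
            exact mul_le_mul (hb D) (abs_weightedScore_le (hϑ j) D) (abs_nonneg _) hb0
        _ = b * (a ^ 2 * ∫ D, ∑ i, |score v (WithLp.toLp 2 ϑ) (D i) j|
              ∂(dataLaw n S ζ (WithLp.toLp 2 ϑ)) + 2 * a) := by
            rw [integral_const_mul, integral_add (hsum.const_mul _) (integrable_const _),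
              integral_const_mul]
            simp
        _ ≤ _ := by
            have := integral_abs_sum_score_le (n := n) (ζ := ζ) hS (WithLp.toLp 2 ϑ) j
            gcongr
  simp_rw [hF]
  refine ⟨hki.integral_prod_left, ?_⟩
  -- The parameter is integrated first with the data frozen: g D is then a constant, and redrawing
  -- coordinate j exposes the vanishing one-dimensional integral.
  rw [integral_integral_swap (f := fun ϑ D => k (ϑ, D)) hki]
  refine integral_eq_zero_of_ae ?_
  filter_upwards [hki.prod_left_ae] with D hD
  have hup := measurePreserving_update (uniformInterval a) j
  have e : ∫ ϑ, k (ϑ, D) ∂(uniformCube d a) = ∫ p : (Fin d → ℝ) × ℝ,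
      k (Function.update p.1 j p.2, D) ∂((uniformCube d a).prod (uniformInterval a)) := by
    conv_lhs => rw [uniformCube, ← hup.map_eq]
    rw [integral_map hup.measurable.aemeasurable]
    · rfl
    · exact (hkm.comp (by fun_prop : Measurable fun ϑ => (ϑ, D))).aestronglyMeasurable
  have hup' : Integrable (fun p : (Fin d → ℝ) × ℝ => k (Function.update p.1 j p.2, D))
      ((uniformCube d a).prod (uniformInterval a)) := hup.integrable_comp_of_integrable hD
  rw [e, integral_prod _ hup']
  refine integral_eq_zero_of_ae (ae_of_all _ fun ϑ => ?_)
  simp only [Pi.zero_apply, hk]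
  rw [integral_uniformInterval ha]
  have h0 := integral_interval_weightedScore v a j ϑ D
  have h1 : ∀ t, dataLikelihoodRatio v (Function.update ϑ j t) D *
      (g D * weightedScore v a j (Function.update ϑ j t) D)
      = g D * (dataLikelihoodRatio v (Function.update ϑ j t) D *
        weightedScore v a j (Function.update ϑ j t) D) := fun t => by ring
  simp_rw [h1]
  rw [intervalIntegral.integral_const_mul, h0]
  simp

end IntegrationByParts

/-- Truncation to `[-a, a]`. -/
def clip (a t : ℝ) : ℝ := max (-a) (min a t)

@[fun_prop]
lemma measurable_clip (a : ℝ) : Measurable (clip a) := by unfold clip; fun_prop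

lemma abs_clip_le {a : ℝ} (ha : 0 ≤ a) (t : ℝ) : |clip a t| ≤ a :=
  abs_le.2 ⟨le_max_left _ _, max_le (by linarith) (min_le_left _ _)⟩

/-- Projection onto an interval does not increase the distance to its points, so truncating the
output costs nothing against parameters in the cube. -/
lemma abs_clip_sub_le {a s : ℝ} (hs : |s| ≤ a) (t : ℝ) : |clip a t - s| ≤ |t - s| := by
  obtain ⟨h1, h2⟩ := abs_le.1 hs
  unfold clip
  rcases le_total a t with h | h
  · rw [min_eq_left h, max_eq_right (by linarith), abs_of_nonneg (by linarith),
      abs_of_nonneg (by linarith)]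
    linarith
  · rw [min_eq_right h]
    rcases le_total (-a) t with h' | h'
    · rw [max_eq_right h']
    · rw [max_eq_left h', abs_of_nonpos (by linarith), abs_of_nonpos (by linarith)]
      linarith

lemma abs_clip_sub_le_two_mul {a s : ℝ} (hs : |s| ≤ a) (t : ℝ) : |clip a t - s| ≤ 2 * a := by
  have := abs_clip_le ((abs_nonneg _).trans hs) t
  have := abs_sub (clip a t) s
  linarith

/-! ### The Bayesian lower bound in terms of error and score correlation -/

section

variable {n d : ℕ} {S : Matrix (Fin d) (Fin d) ℝ} {ζ : ℝ≥0}

/-- Mean squared error of the truncated output of `M`. -/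
def clippedError (S : Matrix (Fin d) (Fin d) ℝ) (ζ : ℝ≥0) (M : Algorithm n d) (a : ℝ)
    (ϑ : Fin d → ℝ) : ℝ :=
  ∫ D, ∫ m, ∑ j, (clip a (m j) - ϑ j) ^ 2 ∂(M D) ∂(dataLaw n S ζ (WithLp.toLp 2 ϑ))

/-- Weighted correlation between the error of the truncated output of `M` and the score. -/
def scoreCorrelation (S : Matrix (Fin d) (Fin d) ℝ) (ζ : ℝ≥0) (M : Algorithm n d) (a : ℝ)
    (ϑ : Fin d → ℝ) : ℝ :=
  ∑ j, ∫ D, (∫ m, (a ^ 2 - ϑ j ^ 2) * (clip a (m j) - ϑ j) ∂(M D)) *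
    ∑ i, score ((ζ : ℝ) ^ 2) (WithLp.toLp 2 ϑ) (D i) j ∂(dataLaw n S ζ (WithLp.toLp 2 ϑ))

variable {M : Algorithm n d}

lemma measurable_integral_algorithm {f : EuclideanSpace ℝ (Fin d) → ℝ} (hf : Measurable f) :
    Measurable fun D => ∫ m, f m ∂(M D) :=
  (hf.stronglyMeasurable.integral_kernel (κ := M)).measurable

variable [IsMarkovKernel M]

lemma integrable_of_abs_le {Ω : Type*} [MeasurableSpace Ω] {μ : Measure Ω} [IsFiniteMeasure μ]
    {f : Ω → ℝ} (hf : Measurable f) {b : ℝ} (hb : ∀ x, |f x| ≤ b) : Integrable f μ :=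
  Integrable.of_bound hf.aestronglyMeasurable b (ae_of_all _ hb)

lemma integrable_integral_algorithm {μ : Measure (Dataset n d)} [IsFiniteMeasure μ]
    {f : EuclideanSpace ℝ (Fin d) → ℝ} (hf : Measurable f) {b : ℝ} (hb : ∀ x, |f x| ≤ b) :
    Integrable (fun D => ∫ m, f m ∂(M D)) μ :=
  integrable_of_abs_le (measurable_integral_algorithm hf) fun _ => abs_integral_le_of_abs_le hb

lemma sq_clip_sub_le {a s : ℝ} (hs : |s| ≤ a) (t : ℝ) : |(clip a t - s) ^ 2| ≤ (2 * a) ^ 2 := by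
  rw [abs_pow]
  exact pow_le_pow_left₀ (abs_nonneg _) (abs_clip_sub_le_two_mul hs t) 2

lemma abs_sum_sq_clip_sub_le {a : ℝ} {ϑ : Fin d → ℝ} (hϑ : ∀ j, |ϑ j| ≤ a)
    (m : EuclideanSpace ℝ (Fin d)) : |∑ j, (clip a (m j) - ϑ j) ^ 2| ≤ ∑ _j : Fin d, (2 * a) ^ 2 :=
  (Finset.abs_sum_le_sum_abs _ _).trans (Finset.sum_le_sum fun j _ => sq_clip_sub_le (hϑ j) _)

lemma measurable_sum_sq_clip_sub (a : ℝ) (ϑ : Fin d → ℝ) :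
    Measurable fun m : EuclideanSpace ℝ (Fin d) => ∑ j, (clip a (m j) - ϑ j) ^ 2 := by
  fun_prop

lemma clippedError_eq_sum {a : ℝ} {ϑ : Fin d → ℝ} (hϑ : ∀ j, |ϑ j| ≤ a) :
    clippedError S ζ M a ϑ = ∑ j, ∫ D, ∫ m, (clip a (m j) - ϑ j) ^ 2 ∂(M D)
      ∂(dataLaw n S ζ (WithLp.toLp 2 ϑ)) := by
  unfold clippedError
  have h1 : ∀ D, ∫ m, ∑ j, (clip a (m j) - ϑ j) ^ 2 ∂(M D)
      = ∑ j, ∫ m, (clip a (m j) - ϑ j) ^ 2 ∂(M D) := fun D =>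
    integral_finsetSum _ fun j _ =>
      integrable_of_abs_le (by fun_prop) fun m => sq_clip_sub_le (hϑ j) (m j)
  simp_rw [h1]
  exact integral_finsetSum _ fun j _ =>
    integrable_integral_algorithm (by fun_prop) fun m => sq_clip_sub_le (hϑ j) (m j)

lemma measurePreserving_eval_dataLaw (θ : EuclideanSpace ℝ (Fin d)) (i : Fin n) :
    MeasurePreserving (fun D : Dataset n d => D i) (dataLaw n S ζ θ) (sampleLaw S ζ θ) :=
  measurePreserving_eval (fun _ : Fin n => sampleLaw S ζ θ) i

lemma integrable_score_eval (v : ℝ) (θ : EuclideanSpace ℝ (Fin d)) (j : Fin d) (i : Fin n) :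
    Integrable (fun D : Dataset n d => score v θ (D i) j) (dataLaw n S ζ θ) :=
  (measurePreserving_eval_dataLaw θ i).integrable_comp_of_integrable
    ((memLp_score v j).integrable (by norm_num))

lemma integrable_sum_score (v : ℝ) (θ : EuclideanSpace ℝ (Fin d)) (j : Fin d) :
    Integrable (fun D : Dataset n d => ∑ i, score v θ (D i) j) (dataLaw n S ζ θ) :=
  integrable_finsetSum _ fun i _ => integrable_score_eval v θ j i

lemma integral_score_eval (v : ℝ) (θ : EuclideanSpace ℝ (Fin d)) (j : Fin d) (i : Fin n) :
    ∫ D : Dataset n d, score v θ (D i) j ∂(dataLaw n S ζ θ) = 0 := by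
  have h := measurePreserving_eval_dataLaw (S := S) (ζ := ζ) θ i
  rw [← integral_score (S := S) (ζ := ζ) (θs := θ) v j, ← h.map_eq,
    integral_map h.measurable.aemeasurable (by fun_prop)]

lemma integral_sum_score (v : ℝ) (θ : EuclideanSpace ℝ (Fin d)) (j : Fin d) :
    ∫ D : Dataset n d, ∑ i, score v θ (D i) j ∂(dataLaw n S ζ θ) = 0 := by
  rw [integral_finsetSum _ fun i _ => integrable_score_eval v θ j i]
  simp [integral_score_eval]

/-- A diagonal entry of the Fisher information of the data: variances of independent centred scores
add. -/
lemma integral_sum_score_sq (hS : S.PosSemidef) (θ : EuclideanSpace ℝ (Fin d)) (j : Fin d) :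
    ∫ D : Dataset n d, (∑ i, score ((ζ : ℝ) ^ 2) θ (D i) j) ^ 2 ∂(dataLaw n S ζ θ)
      = n * (S j j / (ζ : ℝ) ^ 2) := by
  have hL := memLp_score (S := S) (ζ := ζ) (θs := θ) ((ζ : ℝ) ^ 2) j
  have h := variance_sum_pi (μ := fun _ : Fin n => sampleLaw S ζ θ)
    (X := fun _ p => score ((ζ : ℝ) ^ 2) θ p j) fun _ => hL
  rw [variance_of_integral_eq_zero, Finset.sum_const, Finset.card_univ, Fintype.card_fin,
    variance_of_integral_eq_zero (by fun_prop) (integral_score _ j), integral_score_sq hS,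
    nsmul_eq_mul] at h
  · rw [← h]; simp [dataLaw]
  · fun_prop
  · simpa [dataLaw] using integral_sum_score (n := n) (S := S) (ζ := ζ) ((ζ : ℝ) ^ 2) θ j

lemma memLp_sum_score (v : ℝ) (θ : EuclideanSpace ℝ (Fin d)) (j : Fin d) :
    MemLp (fun D : Dataset n d => ∑ i, score v θ (D i) j) 2 (dataLaw n S ζ θ) :=
  memLp_finsetSum _ fun i _ =>
    (memLp_score v j).comp_measurePreserving (measurePreserving_eval_dataLaw θ i)

/-- Pointwise in the parameter, the averaged score is controlled by the correlation and the error. -/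
lemma sum_integral_weightedScore_le {a : ℝ} {ϑ : Fin d → ℝ} (hϑ : ∀ j, |ϑ j| ≤ a) :
    ∑ j, ∫ D, (∫ m, clip a (m j) ∂(M D)) * weightedScore ((ζ : ℝ) ^ 2) a j ϑ D
        ∂(dataLaw n S ζ (WithLp.toLp 2 ϑ))
      ≤ scoreCorrelation S ζ M a ϑ + clippedError S ζ M a ϑ - ∑ j, ϑ j ^ 2 := by
  rw [clippedError_eq_sum hϑ, scoreCorrelation, ← Finset.sum_add_distrib, ← Finset.sum_sub_distrib]
  refine Finset.sum_le_sum fun j _ => ?_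
  set v : ℝ := (ζ : ℝ) ^ 2
  set μ := dataLaw n S ζ (WithLp.toLp 2 ϑ)
  have ha : 0 ≤ a := (abs_nonneg _).trans (hϑ j)
  have hc : Measurable fun m : EuclideanSpace ℝ (Fin d) => clip a (m j) := by fun_prop
  have hcb : ∀ m : EuclideanSpace ℝ (Fin d), |clip a (m j)| ≤ a := fun m => abs_clip_le ha _
  have hs2 : ∀ D, ∫ m, (clip a (m j) - ϑ j) ^ 2 ∂(M D) = ∫ m, clip a (m j) ^ 2 ∂(M D)
      - 2 * ϑ j * ∫ m, clip a (m j) ∂(M D) + ϑ j ^ 2 := by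
    intro D
    have i1 : Integrable (fun m : EuclideanSpace ℝ (Fin d) => clip a (m j)) (M D) :=
      integrable_of_abs_le hc hcb
    have i2 : Integrable (fun m : EuclideanSpace ℝ (Fin d) => clip a (m j) ^ 2) (M D) :=
      integrable_of_abs_le (hc.pow_const 2) (b := a ^ 2) fun m => by
        rw [abs_pow]; exact pow_le_pow_left₀ (abs_nonneg _) (hcb m) 2
    have : ∀ m : EuclideanSpace ℝ (Fin d), (clip a (m j) - ϑ j) ^ 2
        = clip a (m j) ^ 2 - 2 * ϑ j * clip a (m j) + ϑ j ^ 2 := fun m => by ring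
    simp_rw [this]
    have i3 : Integrable (fun m : EuclideanSpace ℝ (Fin d) =>
      clip a (m j) ^ 2 - 2 * ϑ j * clip a (m j)) (M D) := i2.sub (i1.const_mul _)
    rw [integral_add i3 (integrable_const _), integral_sub i2 (i1.const_mul _), integral_const_mul]
    simp
  have hlin : ∀ D, ∫ m, (a ^ 2 - ϑ j ^ 2) * (clip a (m j) - ϑ j) ∂(M D)
      = (a ^ 2 - ϑ j ^ 2) * (∫ m, clip a (m j) ∂(M D) - ϑ j) := by
    intro D
    rw [integral_const_mul, integral_sub (integrable_of_abs_le hc hcb) (integrable_const _)]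
    simp
  set g : Dataset n d → ℝ := fun D => ∫ m, clip a (m j) ∂(M D)
  have hgm : Measurable g := measurable_integral_algorithm hc
  have hgb : ∀ D, |g D| ≤ a := fun D => abs_integral_le_of_abs_le hcb
  have hgi : Integrable g μ := integrable_of_abs_le hgm hgb
  have hsc : Integrable (fun D : Dataset n d => ∑ i, score v (WithLp.toLp 2 ϑ) (D i) j) μ :=
    integrable_sum_score v _ j
  have hgs : Integrable (fun D => g D * ∑ i, score v (WithLp.toLp 2 ϑ) (D i) j) μ :=
    hsc.bdd_mul (c := a) hgm.aestronglyMeasurable (ae_of_all _ hgb)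
  have hei : Integrable (fun D => ∫ m, (clip a (m j) - ϑ j) ^ 2 ∂(M D)) μ :=
    integrable_integral_algorithm (by fun_prop) fun m => sq_clip_sub_le (hϑ j) (m j)
  have e1 : ∫ D, g D * weightedScore v a j ϑ D ∂μ
      = (a ^ 2 - ϑ j ^ 2) * ∫ D, g D * ∑ i, score v (WithLp.toLp 2 ϑ) (D i) j ∂μ
        - 2 * ϑ j * ∫ D, g D ∂μ := by
    rw [← integral_const_mul, ← integral_const_mul, ← integral_sub (hgs.const_mul _)
      (hgi.const_mul _)]
    refine integral_congr_ae (ae_of_all _ fun D => ?_)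
    simp only [weightedScore]
    ring
  -- The score has mean zero, so centring the estimator at ϑ j does not change the correlation.
  have e2 : ∫ D, (∫ m, (a ^ 2 - ϑ j ^ 2) * (clip a (m j) - ϑ j) ∂(M D)) *
      ∑ i, score v (WithLp.toLp 2 ϑ) (D i) j ∂μ
      = (a ^ 2 - ϑ j ^ 2) * ∫ D, g D * ∑ i, score v (WithLp.toLp 2 ϑ) (D i) j ∂μ := by
    have : ∀ D : Dataset n d, (∫ m, (a ^ 2 - ϑ j ^ 2) * (clip a (m j) - ϑ j) ∂(M D)) *
        ∑ i, score v (WithLp.toLp 2 ϑ) (D i) j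
        = (a ^ 2 - ϑ j ^ 2) * (g D * ∑ i, score v (WithLp.toLp 2 ϑ) (D i) j)
          - (a ^ 2 - ϑ j ^ 2) * ϑ j * ∑ i, score v (WithLp.toLp 2 ϑ) (D i) j := by
      intro D
      rw [hlin D]
      ring
    simp_rw [this]
    rw [integral_sub (hgs.const_mul _) (hsc.const_mul _), integral_const_mul, integral_const_mul,
      integral_sum_score v _ j]
    ring
  -- Expand the squared error and drop the nonnegative second moment of the truncated output.
  have e3 : ϑ j ^ 2 - 2 * ϑ j * ∫ D, g D ∂μ
      ≤ ∫ D, ∫ m, (clip a (m j) - ϑ j) ^ 2 ∂(M D) ∂μ := by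
    have : ϑ j ^ 2 - 2 * ϑ j * ∫ D, g D ∂μ = ∫ D, (ϑ j ^ 2 - 2 * ϑ j * g D) ∂μ := by
      rw [integral_sub (integrable_const _) (hgi.const_mul _), integral_const_mul]
      simp
    rw [this]
    refine integral_mono ((integrable_const _).sub (hgi.const_mul _)) hei fun D => ?_
    show ϑ j ^ 2 - 2 * ϑ j * g D ≤ ∫ m, (clip a (m j) - ϑ j) ^ 2 ∂(M D)
    rw [hs2 D]
    have : 0 ≤ ∫ m, clip a (m j) ^ 2 ∂(M D) := integral_nonneg fun _ => sq_nonneg _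
    linarith
  show ∫ D, g D * weightedScore v a j ϑ D ∂μ ≤ _
  rw [e1, e2]
  linarith

/-- Bayesian lower bound for the uniform prior on a cube, given a bound on the correlation with the
score. -/
lemma cube_lower_bound (hS : S.PosSemidef) (hζ : ζ ≠ 0) {a : ℝ} (ha : 0 < a) {B G H : ℝ}
    (hG : 0 ≤ G)
    (hB : ∀ ϑ : Fin d → ℝ, (∀ j, |ϑ j| ≤ a) → clippedError S ζ M a ϑ ≤ B)
    (hT : ∀ ϑ : Fin d → ℝ, (∀ j, |ϑ j| ≤ a) →
      scoreCorrelation S ζ M a ϑ ≤ G * clippedError S ζ M a ϑ + H) :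
    d * (a ^ 2 / 3) ≤ B + G * B + H := by
  have hpc := isProbabilityMeasure_uniformCube d ha
  have hF := fun j : Fin d => integral_uniformCube_weightedScore (n := n) hS hζ ha j
    (g := fun D => ∫ m, clip a (m j) ∂(M D)) (measurable_integral_algorithm (by fun_prop))
    (b := a) fun D => abs_integral_le_of_abs_le fun m => abs_clip_le ha.le _
  have hsqi : ∀ j : Fin d, Integrable (fun ϑ : Fin d → ℝ => ϑ j ^ 2) (uniformCube d a) := by
    intro j
    refine Integrable.of_bound (Measurable.aestronglyMeasurable (by fun_prop)) (a ^ 2) ?_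
    filter_upwards [ae_uniformCube d ha] with ϑ hϑ
    rw [norm_pow]
    exact pow_le_pow_left₀ (norm_nonneg _) (hϑ j) 2
  have h0 : ∫ ϑ, ∑ j, ∫ D, (∫ m, clip a (m j) ∂(M D)) * weightedScore ((ζ : ℝ) ^ 2) a j ϑ D
      ∂(dataLaw n S ζ (WithLp.toLp 2 ϑ)) ∂(uniformCube d a) = 0 := by
    rw [integral_finsetSum _ fun j _ => (hF j).1]
    exact Finset.sum_eq_zero fun j _ => (hF j).2
  have h1 : ∫ ϑ, (B + G * B + H - ∑ j, ϑ j ^ 2) ∂(uniformCube d a)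
      = B + G * B + H - d * (a ^ 2 / 3) := by
    rw [integral_sub (integrable_const _) (integrable_finsetSum _ fun j _ => hsqi j),
      integral_finsetSum _ fun j _ => hsqi j]
    simp [integral_sq_uniformCube d ha]
  have h2 : ∫ ϑ, ∑ j, ∫ D, (∫ m, clip a (m j) ∂(M D)) * weightedScore ((ζ : ℝ) ^ 2) a j ϑ D
      ∂(dataLaw n S ζ (WithLp.toLp 2 ϑ)) ∂(uniformCube d a)
      ≤ ∫ ϑ, (B + G * B + H - ∑ j, ϑ j ^ 2) ∂(uniformCube d a) := by
    refine integral_mono_ae (integrable_finsetSum _ fun j _ => (hF j).1)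
      ((integrable_const _).sub (integrable_finsetSum _ fun j _ => hsqi j)) ?_
    filter_upwards [ae_uniformCube d ha] with ϑ hϑ
    have h3 := sum_integral_weightedScore_le (n := n) (S := S) (ζ := ζ) (M := M) hϑ
    have h4 := hT ϑ hϑ
    have h5 := hB ϑ hϑ
    have h6 := mul_le_mul_of_nonneg_left h5 hG
    linarith
  linarith

end

/-! ### Upper bounds on the score correlation, and passage from risk to error -/

lemma adjacent_update {n d : ℕ} (D : Dataset n d) (i : Fin n) (x : Sample d) :
    Adjacent D (Function.update D i x) :=
  ⟨i, fun _ hj => (Function.update_of_ne hj _ _).symm⟩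

/-- Only the order α = 2 is used: there the Rényi divergence is log(1 + χ²). -/
lemma IsZCDP.lintegral_rnDeriv_sq_le {n d : ℕ} {ρ : ℝ} {M : Algorithm n d}
    (hM : IsZCDP (ρ ^ 2 / 2) M) {D D' : Dataset n d} (h : Adjacent D D') :
    M D ≪ M D' ∧ ∫⁻ m, ((M D).rnDeriv (M D') m) ^ (2 : ℝ) ∂(M D')
      ≤ ENNReal.ofReal (Real.exp (ρ ^ 2)) := by
  have h2 := hM D D' h 2 (by norm_num)
  unfold renyiDiv at h2
  split_ifs at h2 with hac
  · refine ⟨hac, ?_⟩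
    rw [← ENNReal.log_le_log_iff, ENNReal.log_ofReal_of_pos (Real.exp_pos _), Real.log_exp]
    have e1 : ((2 : ℝ) - 1)⁻¹ = 1 := by norm_num
    have e2 : (2 : ℝ) * (ρ ^ 2 / 2) = ρ ^ 2 := by ring
    rw [e1, e2, EReal.coe_one, one_mul] at h2
    exact h2
  · exact absurd h2 (not_le.2 (EReal.coe_lt_top _))

section

variable {n d : ℕ} {S : Matrix (Fin d) (Fin d) ℝ} {ζ : ℝ≥0} {M : Algorithm n d} [IsMarkovKernel M]

lemma sq_weight_mul_le {a s : ℝ} (hs : |s| ≤ a) (t : ℝ) :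
    ((a ^ 2 - s ^ 2) * t) ^ 2 ≤ a ^ 4 * t ^ 2 := by
  have h0 : s ^ 2 ≤ a ^ 2 := sq_le_sq' (abs_le.1 hs).1 (abs_le.1 hs).2
  rw [mul_pow]
  refine mul_le_mul_of_nonneg_right ?_ (sq_nonneg t)
  calc (a ^ 2 - s ^ 2) ^ 2 ≤ (a ^ 2) ^ 2 :=
        pow_le_pow_left₀ (by linarith) (by linarith [sq_nonneg s]) 2
    _ = a ^ 4 := by ring

lemma abs_weight_mul_le {a s : ℝ} (hs : |s| ≤ a) (t : ℝ) :
    |(a ^ 2 - s ^ 2) * (clip a t - s)| ≤ a ^ 2 * (2 * a) := by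
  have h0 : s ^ 2 ≤ a ^ 2 := sq_le_sq' (abs_le.1 hs).1 (abs_le.1 hs).2
  rw [abs_mul, abs_of_nonneg (by linarith)]
  exact mul_le_mul (by linarith [sq_nonneg s]) (abs_clip_sub_le_two_mul hs t) (abs_nonneg _)
    (sq_nonneg a)

/-- Cauchy–Schwarz bound on the correlation with the score, from the Fisher information of the
data. -/
lemma scoreCorrelation_le_of_fisher (hS : S.PosSemidef) {a : ℝ} {ϑ : Fin d → ℝ}
    (hϑ : ∀ j, |ϑ j| ≤ a) {η : ℝ} (hη : 0 < η) :
    scoreCorrelation S ζ M a ϑ ≤ a ^ 4 / (2 * η) * clippedError S ζ M a ϑ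
      + η / 2 * (n * S.trace / (ζ : ℝ) ^ 2) := by
  have htr : η / 2 * (n * S.trace / (ζ : ℝ) ^ 2)
      = ∑ j, η / 2 * (n * (S j j / (ζ : ℝ) ^ 2)) := by
    rw [Matrix.trace, ← Finset.mul_sum, ← Finset.mul_sum, ← Finset.sum_div, mul_div_assoc]
    rfl
  rw [htr, clippedError_eq_sum hϑ, Finset.mul_sum, ← Finset.sum_add_distrib, scoreCorrelation]
  refine Finset.sum_le_sum fun j _ => ?_
  set θ : EuclideanSpace ℝ (Fin d) := WithLp.toLp 2 ϑ
  set s : Dataset n d → ℝ := fun D => ∑ i, score ((ζ : ℝ) ^ 2) θ (D i) j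
  have hs2 : Integrable (fun D => s D ^ 2) (dataLaw n S ζ θ) := (memLp_sum_score _ θ j).integrable_sq
  have hu : Measurable fun m : EuclideanSpace ℝ (Fin d) =>
      (a ^ 2 - ϑ j ^ 2) * (clip a (m j) - ϑ j) := by fun_prop
  have hei : Integrable (fun D => ∫ m, (clip a (m j) - ϑ j) ^ 2 ∂(M D)) (dataLaw n S ζ θ) :=
    integrable_integral_algorithm (by fun_prop) fun m => sq_clip_sub_le (hϑ j) (m j)
  rw [← integral_sum_score_sq hS θ j, ← integral_const_mul, ← integral_const_mul,
    ← integral_add (hei.const_mul _) (hs2.const_mul _)]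
  refine integral_mono ?_ ((hei.const_mul _).add (hs2.const_mul _)) fun D => ?_
  · exact (integrable_sum_score _ θ j).bdd_mul (c := a ^ 2 * (2 * a))
      (measurable_integral_algorithm hu).aestronglyMeasurable
      (ae_of_all _ fun D => abs_integral_le_of_abs_le fun m => abs_weight_mul_le (hϑ j) (m j))
  · show (∫ m, (a ^ 2 - ϑ j ^ 2) * (clip a (m j) - ϑ j) ∂(M D)) * s D
      ≤ a ^ 4 / (2 * η) * ∫ m, (clip a (m j) - ϑ j) ^ 2 ∂(M D) + η / 2 * s D ^ 2
    have i1 : Integrable (fun m : EuclideanSpace ℝ (Fin d) => (clip a (m j) - ϑ j) ^ 2) (M D) :=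
      integrable_of_abs_le (by fun_prop) fun m => sq_clip_sub_le (hϑ j) (m j)
    have e : a ^ 4 / (2 * η) * ∫ m, (clip a (m j) - ϑ j) ^ 2 ∂(M D) + η / 2 * s D ^ 2
        = ∫ m, (a ^ 4 / (2 * η) * (clip a (m j) - ϑ j) ^ 2 + η / 2 * s D ^ 2) ∂(M D) := by
      rw [integral_add (i1.const_mul _) (integrable_const _), integral_const_mul]
      simp
    rw [e, ← integral_mul_const]
    refine integral_mono ((integrable_of_abs_le hu fun m =>
      abs_weight_mul_le (hϑ j) (m j)).mul_const _) ((i1.const_mul _).add (integrable_const _))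
      fun m => ?_
    have h1 := sq_weight_mul_le (hϑ j) (clip a (m j) - ϑ j)
    show (a ^ 2 - ϑ j ^ 2) * (clip a (m j) - ϑ j) * s D
      ≤ a ^ 4 / (2 * η) * (clip a (m j) - ϑ j) ^ 2 + η / 2 * s D ^ 2
    set u := (a ^ 2 - ϑ j ^ 2) * (clip a (m j) - ϑ j)
    -- Cauchy–Schwarz in the form u s ≤ u² / (2η) + η s² / 2, leaving η free to be optimised.
    have h2 : u ^ 2 / (2 * η) + η / 2 * s D ^ 2 - u * s D = (u - η * s D) ^ 2 / (2 * η) := by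
      field_simp; ring
    have h3 : 0 ≤ (u - η * s D) ^ 2 / (2 * η) := by positivity
    have h4 : u ^ 2 / (2 * η) ≤ a ^ 4 * (clip a (m j) - ϑ j) ^ 2 / (2 * η) := by gcongr
    have h5 : a ^ 4 / (2 * η) * (clip a (m j) - ϑ j) ^ 2
      = a ^ 4 * (clip a (m j) - ϑ j) ^ 2 / (2 * η) := by ring
    linarith

/-- Bound on the correlation with the score from the stability of a zCDP algorithm. -/
lemma scoreCorrelation_le_of_isZCDP (hS : S.PosSemidef) {l : ℝ} (hl0 : 0 ≤ l)
    (hl : ∀ i, hS.isHermitian.eigenvalues i ≤ l) {ρ : ℝ} (hM : IsZCDP (ρ ^ 2 / 2) M) {a : ℝ}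
    {ϑ : Fin d → ℝ} (hϑ : ∀ j, |ϑ j| ≤ a) {η : ℝ} (hη : 0 < η) :
    scoreCorrelation S ζ M a ϑ ≤ n * (l * a ^ 4 / (ζ : ℝ) ^ 2 / (2 * η)) * clippedError S ζ M a ϑ
      + n * (η / 2 * (Real.exp (ρ ^ 2) - 1)) := by
  set v : ℝ := (ζ : ℝ) ^ 2
  have hv0 : 0 ≤ v := sq_nonneg _
  set θ : EuclideanSpace ℝ (Fin d) := WithLp.toLp 2 ϑ
  set u : EuclideanSpace ℝ (Fin d) → Fin d → ℝ := fun m j =>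
    (a ^ 2 - ϑ j ^ 2) * (clip a (m j) - ϑ j) with hu
  have hum : ∀ j, Measurable fun m => u m j := fun j => by simp only [hu]; fun_prop
  have hub : ∀ m j, |u m j| ≤ a ^ 2 * (2 * a) := fun m j => abs_weight_mul_le (hϑ j) (m j)
  -- The traced statistic: the score of one sample paired with the weighted error of the output. At
  -- fixed m it is centred, with variance uᵀ S u / v ≤ l ‖u‖² / v, which `h` dominates because the
  -- weights are at most a².
  set f : Sample d → EuclideanSpace ℝ (Fin d) → ℝ := fun p m => ∑ j, u m j * score v θ p j
  set h : EuclideanSpace ℝ (Fin d) → ℝ := fun m =>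
    l * a ^ 4 / v * ∑ j, (clip a (m j) - ϑ j) ^ 2 with hh
  have hfm : Measurable (Function.uncurry f) :=
    Finset.measurable_sum _ fun j _ => ((hum j).comp measurable_snd).mul
      ((measurable_score (v := v) (j := j) (θ := θ)).comp measurable_fst)
  have hfb : ∀ p m, |f p m| ≤ ∑ j, a ^ 2 * (2 * a) * |score v θ p j| := fun p m =>
    (Finset.abs_sum_le_sum_abs _ _).trans (Finset.sum_le_sum fun j _ => by
      rw [abs_mul]; exact mul_le_mul_of_nonneg_right (hub m j) (abs_nonneg _))
  have hb2 : MemLp (fun p => ∑ j, a ^ 2 * (2 * a) * |score v θ p j|) 2 (sampleLaw S ζ θ) :=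
    memLp_finsetSum _ fun j _ => (memLp_score v j).abs.const_mul _
  have hhm : Measurable h := (measurable_sum_sq_clip_sub a ϑ).const_mul _
  have hhb : ∀ m, |h m| ≤ |l * a ^ 4 / v| * ∑ _j : Fin d, (2 * a) ^ 2 := fun m => by
    simp only [hh]
    rw [abs_mul]
    exact mul_le_mul_of_nonneg_left (abs_sum_sq_clip_sub_le hϑ m) (abs_nonneg _)
  have hf0 : ∀ m, ∫ p, f p m ∂(sampleLaw S ζ θ) = 0 := fun m =>
    integral_combination_score v (WithLp.toLp 2 (u m))
  have hf2 : ∀ m, ∫ p, f p m ^ 2 ∂(sampleLaw S ζ θ) ≤ h m := fun m => by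
    have e1 := integral_combination_score_sq (ζ := ζ) (θs := θ) hS (WithLp.toLp 2 (u m))
    have e2 := quadraticForm_le hS.isHermitian hl (WithLp.toLp 2 (u m))
    rw [EuclideanSpace.real_norm_sq_eq] at e2
    have e3 : ∑ j, (WithLp.toLp 2 (u m)) j ^ 2 ≤ a ^ 4 * ∑ j, (clip a (m j) - ϑ j) ^ 2 := by
      rw [Finset.mul_sum]
      exact Finset.sum_le_sum fun j _ => sq_weight_mul_le (hϑ j) _
    calc ∫ p, f p m ^ 2 ∂(sampleLaw S ζ θ) = _ := e1
      _ ≤ (l * (a ^ 4 * ∑ j, (clip a (m j) - ϑ j) ^ 2)) / v := by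
          gcongr
          exact e2.trans (mul_le_mul_of_nonneg_left e3 hl0)
      _ = h m := by simp only [hh]; ring
  have htrace := fun i : Fin n => integral_trace_le (sampleLaw S ζ θ) M i (χ := Real.exp (ρ ^ 2) - 1)
    (fun D x => by rw [add_sub_cancel]; exact hM.lintegral_rnDeriv_sq_le (adjacent_update D i x))
    hfm hfb hb2 hhm hhb hf0 hf2 hη
  have hint : ∀ (i : Fin n) (j : Fin d), Integrable (fun D : Dataset n d =>
      (∫ m, u m j ∂(M D)) * score v θ (D i) j) (dataLaw n S ζ θ) := fun i j =>
    (integrable_score_eval v θ j i).bdd_mul (c := a ^ 2 * (2 * a))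
      (measurable_integral_algorithm (hum j)).aestronglyMeasurable
      (ae_of_all _ fun D => abs_integral_le_of_abs_le fun m => hub m j)
  have hsum : scoreCorrelation S ζ M a ϑ
      = ∑ i, ∫ D, ∫ m, f (D i) m ∂(M D) ∂(dataLaw n S ζ θ) := by
    have e1 : ∀ i : Fin n, ∫ D, ∫ m, f (D i) m ∂(M D) ∂(dataLaw n S ζ θ)
        = ∑ j, ∫ D, (∫ m, u m j ∂(M D)) * score v θ (D i) j ∂(dataLaw n S ζ θ) := by
      intro i
      rw [← integral_finsetSum _ fun j _ => hint i j]
      refine integral_congr_ae (ae_of_all _ fun D => ?_)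
      show ∫ m, ∑ j, u m j * score v θ (D i) j ∂(M D) = _
      rw [integral_finsetSum _ fun j _ =>
        (integrable_of_abs_le (hum j) fun m => hub m j).mul_const _]
      exact Finset.sum_congr rfl fun j _ => integral_mul_const _ _
    simp_rw [e1]
    rw [Finset.sum_comm, scoreCorrelation]
    refine Finset.sum_congr rfl fun j _ => ?_
    rw [← integral_finsetSum _ fun i _ => hint i j]
    simp_rw [← Finset.mul_sum]
    rfl
  have herr : ∫ D, ∫ m, h m ∂(M D) ∂(dataLaw n S ζ θ)
      = l * a ^ 4 / v * clippedError S ζ M a ϑ := by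
    simp only [hh, integral_const_mul]
    rfl
  rw [hsum]
  calc ∑ i, ∫ D, ∫ m, f (D i) m ∂(M D) ∂(dataLaw n S ζ θ)
      ≤ ∑ _i : Fin n, (1 / (2 * η) * (l * a ^ 4 / v * clippedError S ζ M a ϑ)
          + η / 2 * (Real.exp (ρ ^ 2) - 1)) := by
        refine Finset.sum_le_sum fun i _ => ?_
        rw [← herr]
        exact htrace i
    _ = _ := by
        rw [Finset.sum_const, Finset.card_univ, Fintype.card_fin, nsmul_eq_mul]
        ring

/-- The lower eigenvalue bound turns risk into squared error, and truncation decreases the latter.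
The truncated error is bounded, so the passage to `∫⁻` needs no integrability of the raw output. -/
lemma ofReal_clippedError_le_expectedExcessRisk (hS : S.PosSemidef) {l : ℝ} (hl0 : 0 ≤ l)
    (hl : ∀ i, l ≤ hS.isHermitian.eigenvalues i) {a : ℝ} {ϑ : Fin d → ℝ} (hϑ : ∀ j, |ϑ j| ≤ a) :
    ENNReal.ofReal (l / 2 * clippedError S ζ M a ϑ)
      ≤ expectedExcessRisk S ζ M (WithLp.toLp 2 ϑ) := by
  set h : EuclideanSpace ℝ (Fin d) → ℝ := fun m => ∑ j, (clip a (m j) - ϑ j) ^ 2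
  have hhm : Measurable fun m => l / 2 * h m := (measurable_sum_sq_clip_sub a ϑ).const_mul _
  have hb : ∀ m, |l / 2 * h m| ≤ |l / 2| * ∑ _j : Fin d, (2 * a) ^ 2 := fun m => by
    rw [abs_mul]
    exact mul_le_mul_of_nonneg_left (abs_sum_sq_clip_sub_le hϑ m) (abs_nonneg _)
  have h0 : ∀ m, 0 ≤ l / 2 * h m := fun m =>
    mul_nonneg (by linarith) (Finset.sum_nonneg fun _ _ => sq_nonneg _)
  have e : l / 2 * clippedError S ζ M a ϑ
      = ∫ D, ∫ m, l / 2 * h m ∂(M D) ∂(dataLaw n S ζ (WithLp.toLp 2 ϑ)) := by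
    simp only [integral_const_mul]
    rfl
  rw [e, ofReal_integral_eq_lintegral_ofReal (integrable_integral_algorithm hhm hb)
    (ae_of_all _ fun D => integral_nonneg h0), expectedExcessRisk]
  refine lintegral_mono fun D => ?_
  simp only
  rw [ofReal_integral_eq_lintegral_ofReal (integrable_of_abs_le hhm hb) (ae_of_all _ h0)]
  refine lintegral_mono fun m => ENNReal.ofReal_le_ofReal ?_
  rw [excessRisk_eq hS]
  have e1 := le_quadraticForm hS.isHermitian hl (m - WithLp.toLp 2 ϑ)
  have e2 : h m ≤ ‖m - WithLp.toLp 2 ϑ‖ ^ 2 := by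
    rw [EuclideanSpace.real_norm_sq_eq]
    refine Finset.sum_le_sum fun j _ => ?_
    rw [← sq_abs, ← sq_abs ((m - WithLp.toLp 2 ϑ) j)]
    exact pow_le_pow_left₀ (abs_nonneg _) (abs_clip_sub_le (hϑ j) (m j)) 2
  have e3 := mul_le_mul_of_nonneg_left e2 hl0
  have e5 := e3.trans e1
  simp only [WithLp.ofLp_sub] at e5 ⊢
  linarith

end

/-! ### Choice of constants and the nonasymptotic bound -/

section

variable {n d : ℕ} {S : Matrix (Fin d) (Fin d) ℝ} {ζ : ℝ≥0} {M : Algorithm n d} [IsMarkovKernel M]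

lemma error_lower_bound_of_fisher (hS : S.PosSemidef) (hζ : ζ ≠ 0) (htr : S.trace = d)
    (hn : 0 < n) (hd : 0 < d) {a : ℝ} (ha : 0 < a) (had : d * a ^ 2 = 1 / 4) {B : ℝ}
    (hB : ∀ ϑ : Fin d → ℝ, (∀ j, |ϑ j| ≤ a) → clippedError S ζ M a ϑ ≤ B) :
    1 / 24 ≤ B * (1 + 3 / 8 * (n / d) / (ζ : ℝ) ^ 2) := by
  have hv : 0 < (ζ : ℝ) ^ 2 := by positivity
  have hn' : (0 : ℝ) < n := by exact_mod_cast hn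
  have hd' : (0 : ℝ) < d := by exact_mod_cast hd
  have ha2 : a ^ 2 = 1 / (4 * d) := by field_simp; linarith
  -- Chosen so that the additive term is 1/24, half of the prior contribution d a² / 3 = 1/12.
  set η : ℝ := a ^ 2 * (ζ : ℝ) ^ 2 / (3 * n) with hη
  have hη0 : 0 < η := by positivity
  have h := cube_lower_bound (n := n) (M := M) (B := B) (G := a ^ 4 / (2 * η))
    (H := η / 2 * (n * S.trace / (ζ : ℝ) ^ 2)) hS hζ ha (by positivity) hB
    fun ϑ hϑ => scoreCorrelation_le_of_fisher hS hϑ hη0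
  have e1 : a ^ 4 / (2 * η) = 3 / 8 * (n / d) / (ζ : ℝ) ^ 2 := by
    have : a ^ 4 / (2 * η) = 3 / 2 * a ^ 2 * n / (ζ : ℝ) ^ 2 := by
      rw [hη]; field_simp
    rw [this, ha2]; field_simp; norm_num
  have e2 : η / 2 * (n * S.trace / (ζ : ℝ) ^ 2) = 1 / 24 := by
    rw [htr, hη, ha2]; field_simp; norm_num
  have e3 : d * (a ^ 2 / 3) = 1 / 12 := by linarith
  rw [e1, e2, e3] at h
  linarith

lemma error_lower_bound_of_isZCDP (hS : S.PosSemidef) (hζ : ζ ≠ 0) {l : ℝ} (hl0 : 0 < l)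
    (hl : ∀ i, hS.isHermitian.eigenvalues i ≤ l) {ρ : ℝ} (hρ : 0 < ρ) (hρ1 : ρ ≤ 1)
    (hM : IsZCDP (ρ ^ 2 / 2) M)
    (hn : 0 < n) (hd : 0 < d) {a : ℝ} (ha : 0 < a) (had : d * a ^ 2 = 1 / 4) {B : ℝ}
    (hB : ∀ ϑ : Fin d → ℝ, (∀ j, |ϑ j| ≤ a) → clippedError S ζ M a ϑ ≤ B) :
    1 / 24 ≤ B * (1 + 3 / 4 * l * ρ ^ 2 * (n / d) ^ 2 / (ζ : ℝ) ^ 2) := by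
  have hv : 0 < (ζ : ℝ) ^ 2 := by positivity
  have hn' : (0 : ℝ) < n := by exact_mod_cast hn
  have hd' : (0 : ℝ) < d := by exact_mod_cast hd
  have ha2 : a ^ 2 = 1 / (4 * d) := by field_simp; linarith
  -- The additive term is again at most 1/24, using exp(ρ²) - 1 ≤ 2ρ², valid since ρ ≤ 1.
  set η : ℝ := a ^ 2 * d / (6 * n * ρ ^ 2) with hη
  have hη0 : 0 < η := by positivity
  have h := cube_lower_bound (n := n) (M := M) (B := B)
    (G := n * (l * a ^ 4 / (ζ : ℝ) ^ 2 / (2 * η)))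
    (H := n * (η / 2 * (Real.exp (ρ ^ 2) - 1))) hS hζ ha (by positivity) hB
    fun ϑ hϑ => scoreCorrelation_le_of_isZCDP hS hl0.le hl hM hϑ hη0
  have e1 : n * (l * a ^ 4 / (ζ : ℝ) ^ 2 / (2 * η))
      = 3 / 4 * l * ρ ^ 2 * (n / d) ^ 2 / (ζ : ℝ) ^ 2 := by
    have : n * (l * a ^ 4 / (ζ : ℝ) ^ 2 / (2 * η))
        = 3 * l * ρ ^ 2 * n ^ 2 * a ^ 2 / (ζ : ℝ) ^ 2 / d := by
      rw [hη]; field_simp; norm_num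
    rw [this, ha2]; field_simp
  have e2 : n * (η / 2 * (Real.exp (ρ ^ 2) - 1)) ≤ 1 / 24 := by
    have hρ2 : |ρ ^ 2| ≤ 1 := by rw [abs_of_nonneg (sq_nonneg ρ)]; nlinarith
    have hexp := (le_abs_self _).trans (Real.abs_exp_sub_one_le hρ2)
    rw [abs_of_nonneg (sq_nonneg ρ)] at hexp
    calc n * (η / 2 * (Real.exp (ρ ^ 2) - 1)) ≤ n * (η / 2 * (2 * ρ ^ 2)) := by gcongr
      _ = 1 / 24 := by rw [hη, ha2]; field_simp; norm_num
  have e3 : d * (a ^ 2 / 3) = 1 / 12 := by linarith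
  rw [e1, e3] at h
  linarith

lemma norm_toLp_lt_one {a : ℝ} (had : d * a ^ 2 = 1 / 4) {ϑ : Fin d → ℝ} (hϑ : ∀ j, |ϑ j| ≤ a) :
    ‖(WithLp.toLp 2 ϑ : EuclideanSpace ℝ (Fin d))‖ < 1 := by
  have h1 : ‖(WithLp.toLp 2 ϑ : EuclideanSpace ℝ (Fin d))‖ ^ 2 ≤ 1 / 4 := by
    rw [EuclideanSpace.real_norm_sq_eq, ← had]
    calc ∑ j, ϑ j ^ 2 ≤ ∑ _j : Fin d, a ^ 2 := Finset.sum_le_sum fun j _ =>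
          sq_le_sq' (abs_le.1 (hϑ j)).1 (abs_le.1 (hϑ j)).2
      _ = d * a ^ 2 := by simp
  by_contra h
  nlinarith

end

/-- Nonasymptotic minimax lower bound. -/
lemma le_minimaxRisk {n d : ℕ} {S : Matrix (Fin d) (Fin d) ℝ} {ζ : ℝ≥0} (hS : S.PosSemidef)
    {lmin l w K γ ρ c : ℝ} (hlmin : 0 < lmin) (hl0 : 0 < l) (hw : 0 < w)
    (hmin : ∀ i, lmin ≤ hS.isHermitian.eigenvalues i) (hmax : ∀ i, hS.isHermitian.eigenvalues i ≤ l)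
    (htr : S.trace = d) (hζ : w ≤ (ζ : ℝ) ^ 2) (hn : 0 < n) (hd : 0 < d) (hγ : 0 < γ) (hγ1 : γ < 1)
    (hρ : 0 < ρ) (hK : γ ^ 2 / ρ ^ 2 ≤ K) (hnd : (n : ℝ) / d ≤ 2 / γ) (hc : 0 < c)
    (hc1 : c * (24 * (1 + 3 / (4 * w))) ≤ 1) (hc2 : c * (24 * (K + 3 * l / w)) ≤ 1) :
    ENNReal.ofReal (lmin / 2 * (c / 4 * (γ + γ ^ 2 / ρ ^ 2))) ≤ minimaxRisk n S ζ ρ := by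
  refine le_iInf fun M => le_iInf fun hMk => le_iInf fun hM => ?_
  -- If the worst-case risk were smaller, every parameter in the cube would have truncated error at
  -- most the B below.
  by_contra! hlt
  set q : ℝ := γ ^ 2 / ρ ^ 2 with hq
  have hq0 : 0 < q := by positivity
  set B : ℝ := c / 4 * (γ + q) with hBdef
  have hB0 : 0 < B := by positivity
  have hd' : (0 : ℝ) < d := by exact_mod_cast hd
  have hn' : (0 : ℝ) < n := by exact_mod_cast hn
  have hζ0 : ζ ≠ 0 := by
    rintro rfl
    norm_num at hζ
    linarith
  -- Gives d a² = 1/4, so the cube lies in the ball of radius 1/2.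
  set a : ℝ := √(1 / (4 * d)) with ha
  have ha0 : 0 < a := Real.sqrt_pos.2 (by positivity)
  have had : d * a ^ 2 = 1 / 4 := by
    rw [ha, Real.sq_sqrt (by positivity)]; field_simp
  have hB : ∀ ϑ : Fin d → ℝ, (∀ j, |ϑ j| ≤ a) → clippedError S ζ M a ϑ ≤ B := by
    intro ϑ hϑ
    have h1 := ofReal_clippedError_le_expectedExcessRisk (ζ := ζ) (M := M) hS hlmin.le hmin hϑ
    have h2 : expectedExcessRisk S ζ M (WithLp.toLp 2 ϑ)
        ≤ ⨆ (θs : EuclideanSpace ℝ (Fin d)) (_ : ‖θs‖ < 1), expectedExcessRisk S ζ M θs :=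
      le_iSup₂ (f := fun (θs : EuclideanSpace ℝ (Fin d)) (_ : ‖θs‖ < 1) =>
        expectedExcessRisk S ζ M θs) _ (norm_toLp_lt_one had hϑ)
    have h3 := (ENNReal.ofReal_lt_ofReal_iff (by positivity)).1 ((h1.trans h2).trans_lt hlt)
    exact (lt_of_mul_lt_mul_left h3 (by positivity)).le
  have hstat : c * γ ≤ B := by
    have h1 := error_lower_bound_of_fisher hS hζ0 htr hn hd ha0 had hB
    have h2 : 3 / 8 * ((n : ℝ) / d) / (ζ : ℝ) ^ 2 ≤ 3 / 8 * (2 / γ) / w := by gcongr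
    have h3 : 1 / 24 ≤ B * (1 + 3 / 8 * (2 / γ) / w) := h1.trans (by gcongr)
    have h4 : γ * (B * (1 + 3 / 8 * (2 / γ) / w)) = B * (γ + 3 / (4 * w)) := by field_simp; ring
    have h5 : γ * (1 / 24) ≤ B * (1 + 3 / (4 * w)) :=
      (mul_le_mul_of_nonneg_left h3 hγ.le).trans (h4.trans_le (by gcongr))
    have h6 := mul_le_mul_of_nonneg_left h5 hc.le
    have h7 := mul_le_mul_of_nonneg_left hc1 hB0.le
    nlinarith
  have hpriv : c * q ≤ B := by
    -- Tracing is informative only for small ρ; for ρ ≥ 1 the target q is at most γ and the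
    -- statistical bound covers it. In the first case q ≤ K absorbs the constant term.
    rcases le_total ρ 1 with hρ1 | hρ1
    · have h1 := error_lower_bound_of_isZCDP hS hζ0 hl0 hmax hρ hρ1 hM hn hd ha0 had hB
      have h2 : 3 / 4 * l * ρ ^ 2 * ((n : ℝ) / d) ^ 2 / (ζ : ℝ) ^ 2
          ≤ 3 / 4 * l * ρ ^ 2 * (2 / γ) ^ 2 / w := by gcongr
      have h3 : 1 / 24 ≤ B * (1 + 3 / 4 * l * ρ ^ 2 * (2 / γ) ^ 2 / w) := h1.trans (by gcongr)
      have h4 : q * (B * (1 + 3 / 4 * l * ρ ^ 2 * (2 / γ) ^ 2 / w)) = B * (q + 3 * l / w) := by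
        rw [hq]; field_simp; ring
      have h5 : q * (1 / 24) ≤ B * (K + 3 * l / w) :=
        (mul_le_mul_of_nonneg_left h3 hq0.le).trans (h4.trans_le (by gcongr))
      have h6 := mul_le_mul_of_nonneg_left h5 hc.le
      have h7 := mul_le_mul_of_nonneg_left hc2 hB0.le
      nlinarith
    · have h1 : q ≤ γ := by
        rw [hq, div_le_iff₀ (by positivity), pow_two]
        exact mul_le_mul_of_nonneg_left (hγ1.le.trans (one_le_pow₀ hρ1)) hγ.le
      exact (mul_le_mul_of_nonneg_left h1 hc.le).trans hstat
  -- Adding the two bounds gives c (γ + q) ≤ 2B = c (γ + q) / 2, which is impossible.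
  have : 0 < c * (γ + q) := by positivity
  have e : B = c * (γ + q) / 4 := by rw [hBdef]; ring
  linarith

end DPReg
end

theorem theorem5p3 (lmin lmax ζmin ζmax K : ℝ) (hlmin : 0 < lmin) (hζmin : 0 < ζmin) :
    ∃ C : ℝ, 0 < C ∧ ∃ γ₀ : ℝ, 0 < γ₀ ∧
      ∀ γ ρ : ℝ, 0 < γ → γ < γ₀ → 0 < ρ → γ ^ 2 / ρ ^ 2 ≤ K →
      ∀ (n d : ℕ → ℕ) (S : ∀ k, Matrix (Fin (d k)) (Fin (d k)) ℝ) (ζ : ℕ → ℝ≥0)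
        (hS : ∀ k, (S k).PosSemidef),
        Tendsto n atTop atTop → Tendsto d atTop atTop →
        Tendsto (fun k => (d k : ℝ) / (n k : ℝ)) atTop (𝓝 γ) →
        (∀ k i, lmin ≤ (hS k).isHermitian.eigenvalues i ∧
          (hS k).isHermitian.eigenvalues i ≤ lmax) →
        (∀ k, (S k).trace = (d k : ℝ)) →
        (∀ k, ζmin ≤ (ζ k : ℝ) ^ 2 ∧ (ζ k : ℝ) ^ 2 ≤ ζmax) →
        ∀ᶠ k in atTop,
          ENNReal.ofReal (C * (γ + γ ^ 2 / ρ ^ 2)) ≤ DPReg.minimaxRisk (n k) (S k) (ζ k) ρ := by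
  set l : ℝ := max lmax 1
  -- No sign is assumed for `lmax` or `K`; taking the maximum with 1 makes the constants positive.
  have hl0 : 0 < l := lt_max_of_lt_right one_pos
  set c₁ : ℝ := 24 * (1 + 3 / (4 * ζmin))
  have hc₁ : 0 < c₁ := by positivity
  set c₂ : ℝ := 24 * (max K 1 + 3 * l / ζmin)
  have hc₂ : 0 < c₂ := by
    have : 0 < max K 1 := lt_max_of_lt_right one_pos
    positivity
  set c : ℝ := min (1 / c₁) (1 / c₂)
  have hc : 0 < c := lt_min (by positivity) (by positivity)
  refine ⟨lmin / 2 * (c / 4), by positivity, 1, one_pos, ?_⟩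
  intro γ ρ hγ hγ1 hρ hK n d S ζ hS hn hd hnd heig htr hζ
  -- The limit enters only through d / n > γ / 2 eventually, that is n / d ≤ 2 / γ.
  filter_upwards [hn.eventually_gt_atTop 0, hd.eventually_gt_atTop 0,
    hnd.eventually_const_lt (half_lt_self hγ)] with k hnk hdk hk
  have hn' : (0 : ℝ) < n k := by exact_mod_cast hnk
  have hd' : (0 : ℝ) < d k := by exact_mod_cast hdk
  have hratio : (n k : ℝ) / d k ≤ 2 / γ := by
    rw [lt_div_iff₀ hn'] at hk
    rw [div_le_div_iff₀ hd' hγ]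
    linarith
  rw [mul_assoc]
  exact DPReg.le_minimaxRisk (hS k) hlmin hl0 hζmin (fun i => (heig k i).1)
    (fun i => (heig k i).2.trans (le_max_left _ _)) (htr k) (hζ k).1 hnk hdk hγ hγ1 hρ
    (hK.trans (le_max_left K 1)) hratio hc ((le_div_iff₀ hc₁).1 (min_le_left _ _))
    ((le_div_iff₀ hc₂).1 (min_le_right _ _))
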